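/- Setting. Let $D\ge 1$, $k\in\mathbb N$, $\gamma\ge 1$, $g,g_0\in\mathbb R$ and $\mu_0>0$ be given. Consider any finite connected graph with vertex set $\Lambda$, $n=|\Lambda|$, and graph distance $d_{i,j}$; put $d_{X,Y}=\min_{x\in X,y\in Y}d_{x,y}$, $\partial X=\{i\in X: d_{\{i\},X^{c}}=1\}$ and $i[r]=\{j: d_{i,j}\le r\}$, and assume $|\partial (i[r])|\le\gamma r^{D-1}$ and $|i[r]|\le \gamma r^{D}$ for all $i\in\Lambda$ and all real $r\ge 1$. To each site is attached the Hilbert space $\mathbb C^{d_0}$, $d_0\ge1$. Let $H=\sum_{Z\subseteq\Lambda}h_Z$ with $h_Z$ self-adjoint and supported on $Z$, $h_Z=0$ if $|Z|>k$, $\sum_{Z\ni i}\|h_Z\|\le g$ for all $i$, and $\sum_{Z\supseteq\{i,j\}}\|h_Z\|\le g_0e^{-\mu_0 d_{i,j}}$ for all $i\ne j$ (operator norm). For $\beta>0$ let $\rho_\beta=e^{-\beta H}/\mathrm{tr}\,e^{-\beta H}$. We say that $H$ satisfies the Lieb–Robinson bound with constants $C,v,\mu>0$ if, with $O_X(t)=e^{iHt}O_Xe^{-iHt}$,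 $$\|[O_X(t),O_Y]\|\le C\min(|\partial X|,|\partial Y|)\,(e^{v|t|}-1)\,e^{-\mu d_{X,Y}}\qquad(t\in\mathbb R)$$ for all nonempty $X,Y\subseteq\Lambda$ with $d_{X,Y}>0$ and all operators $O_X,O_Y$ of unit norm supported on $X$ and $Y$, respectively. Statement. (a) There are constants $C,v,\mu>0$, depending only on $D,k,\gamma,g,g_0,\mu_0$ (in particular not on $n$, the graph, $d_0$ or the interaction), such that every such $H$ satisfies the Lieb–Robinson bound with constants $C,v,\mu$. (b) For any $C,v,\mu>0$ put $$C'_\beta=\frac{12+2C}{\pi}+\frac{4C}{v\beta},\qquad \frac1{\xi'_\beta}=\frac{\mu}{2+v\beta/\pi},\qquad \tilde C'_\beta=C'_\beta\Big[(\mu/2)^D+\gamma e^{\mu/2}D!\Big].$$ Then $\tilde C'_\beta\,\xi_\beta'^{D}=O(\beta^D)$ as $\beta\to\infty$. Moreover, for every such $H$ that satisfies the Lieb–Robinson bound with constants $C,v,\mu$, every $\beta>0$, and every $K=\sum_{i\in\Lambda}O_i$ with $O_i$ supported on the site $i$ and $\|O_i\|\le 1$, the Wigner–Yanase–Dyson skew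 information satisfies, for all $0\le\alpha\le1$, $$\big|\mathcal I^{(\alpha)}_{\rho_\beta}(K)\big|\le \tilde C'_\beta\,\xi_\beta'^{D}\,n,\qquad \mathcal I^{(\alpha)}_{\rho}(K)=\mathrm{tr}(\rho K^2)-\mathrm{tr}(\rho^{1-\alpha}K\rho^{\alpha}K)$$ (the $O_i$ need not be self-adjoint; if $K$ is self-adjoint, $\mathcal I^{(\alpha)}_{\rho}(K)$ is real), and the quantum Fisher information satisfies $$\mathcal F_{\rho_\beta}(K)\le 8\,\tilde C'_\beta\,\xi_\beta'^{D}\,n,\qquad \mathcal F_\rho(K)=\sum_{s,s'}\frac{2(\lambda_s-\lambda_{s'})^2}{\lambda_s+\lambda_{s'}}\,|\langle\lambda_s|K|\lambda_{s'}\rangle|^2,\quad \rho=\sum_s\lambda_s|\lambda_s\rangle\langle\lambda_s| .$$ -/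

import Mathlib

open scoped Matrix.Norms.L2Operator

noncomputable section

/-! ## Lattice geometry -/

namespace Lattice

variable {Λ : Type} [Fintype Λ] [DecidableEq Λ]

/-- Distance `d_{X,Y}` between two (nonempty) sets of sites: the length of a shortest path of the
graph `G` connecting them. -/
def setDist (G : SimpleGraph Λ) (X Y : Finset Λ) : ℕ :=
  sInf {m : ℕ | ∃ x ∈ X, ∃ y ∈ Y, G.dist x y = m}

/-- The surface `∂X = {i ∈ X : d_{i,Xᶜ} = 1}`. -/
def surface (G : SimpleGraph Λ) (X : Finset Λ) : Finset Λ :=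
  X.filter fun i => setDist G {i} Xᶜ = 1

open Classical in
/-- The ball `i[r] = {j : d_{i,j} ≤ r}`. -/
def ball (G : SimpleGraph Λ) (i : Λ) (r : ℝ) : Finset Λ :=
  Finset.univ.filter fun j => (G.dist i j : ℝ) ≤ r

/-- `D`-dimensional growth with structure constant `γ`: for all real `r ≥ 1` and all sites `i`,
`|∂(i[r])| ≤ γ r ^ (D - 1)` and `|i[r]| ≤ γ r ^ D`. (Used with `1 ≤ D`.) -/
def HasGrowth (G : SimpleGraph Λ) (D : ℕ) (γ : ℝ) : Prop :=
  ∀ (i : Λ) (r : ℝ), 1 ≤ r →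
    ((surface G (ball G i r)).card : ℝ) ≤ γ * r ^ (D - 1) ∧
    ((ball G i r).card : ℝ) ≤ γ * r ^ D

end Lattice

/-! ## Operators on the many-body Hilbert space `⨂_{i ∈ Λ} ℂ^{d₀}` -/

/-- Operators on `⨂_{i ∈ Λ} ℂ^{d₀}`, as matrices in the product basis (indexed by configurations
`Λ → Fin d₀`). The norm is the operator norm. -/
abbrev ManyBodyOp (Λ : Type) (d₀ : ℕ) : Type :=
  Matrix (Λ → Fin d₀) (Λ → Fin d₀) ℂ

namespace ManyBodyOp

variable {Λ : Type} [Fintype Λ] [DecidableEq Λ] {d₀ : ℕ}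

open Classical in
/-- The operator `a ⊗ 1_{Xᶜ}` for an operator `a` on `⨂_{i ∈ X} ℂ^{d₀}`. -/
def embed (X : Finset Λ) (a : Matrix (X → Fin d₀) (X → Fin d₀) ℂ) : ManyBodyOp Λ d₀ :=
  fun σ τ => if ∀ i, i ∉ X → σ i = τ i then a (fun i => σ i) (fun i => τ i) else 0

/-- `A` is supported on `X` (acts only on the sites of `X`). -/
def SupportedOn (X : Finset Λ) (A : ManyBodyOp Λ d₀) : Prop :=
  ∃ a : Matrix (X → Fin d₀) (X → Fin d₀) ℂ, A = embed X a

/-- Heisenberg evolution `O(t) = e^{iHt} O e^{-iHt}`. -/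
def evolve (H : ManyBodyOp Λ d₀) (t : ℝ) (O : ManyBodyOp Λ d₀) : ManyBodyOp Λ d₀ :=
  NormedSpace.exp ((Complex.I * t) • H) * O * NormedSpace.exp ((-(Complex.I * t)) • H)

/-- The Gibbs state `ρ_β = e^{-βH} / tr e^{-βH}`. -/
def gibbs (H : ManyBodyOp Λ d₀) (β : ℝ) : ManyBodyOp Λ d₀ :=
  (Matrix.trace (NormedSpace.exp ((-β) • H)))⁻¹ • NormedSpace.exp ((-β) • H)

theorem isHermitian_gibbs {H : ManyBodyOp Λ d₀} (hH : H.IsHermitian) (β : ℝ) :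
    (gibbs H β).IsHermitian := by
  have h1 : ((-β) • H).IsHermitian := by
    unfold Matrix.IsHermitian
    rw [Matrix.conjTranspose_smul, hH.eq]
    simp
  have h2 : (NormedSpace.exp ((-β) • H)).IsHermitian := h1.exp
  unfold gibbs Matrix.IsHermitian
  rw [Matrix.conjTranspose_smul, h2.eq, star_inv₀, ← Matrix.trace_conjTranspose, h2.eq]

/-- The real power `ρ ^ s` of a self-adjoint nonnegative operator, by functional calculus
(with `0 ^ 0 = 1`). -/
def power (ρ : ManyBodyOp Λ d₀) (s : ℝ) : ManyBodyOp Λ d₀ :=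
  cfc (fun x : ℝ => x ^ s) ρ

/-- The Wigner-Yanase-Dyson skew information
`I_ρ^{(α)}(K) = tr (ρ K²) - tr (ρ^{1-α} K ρ^α K)`. It is a complex number for a general operator
`K`, and a real one when `K` is self-adjoint. -/
def skewInformation (ρ : ManyBodyOp Λ d₀) (α : ℝ) (K : ManyBodyOp Λ d₀) : ℂ :=
  Matrix.trace (ρ * K ^ 2) - Matrix.trace (power ρ (1 - α) * K * power ρ α * K)

/-- The quantum Fisher information
`F_ρ(K) = ∑_{s,s'} 2 (λ_s - λ_{s'})² / (λ_s + λ_{s'}) |⟨λ_s|K|λ_{s'}⟩|²`, where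
`ρ = ∑_s λ_s |λ_s⟩⟨λ_s|` (terms with `λ_s = λ_{s'} = 0` are zero). -/
def fisherInformation (ρ : ManyBodyOp Λ d₀) (hρ : ρ.IsHermitian) (K : ManyBodyOp Λ d₀) : ℝ :=
  ∑ s, ∑ s', 2 * (hρ.eigenvalues s - hρ.eigenvalues s') ^ 2 /
      (hρ.eigenvalues s + hρ.eigenvalues s') *
    ‖star (hρ.eigenvectorBasis s).ofLp ⬝ᵥ K.mulVec (hρ.eigenvectorBasis s').ofLp‖ ^ 2

end ManyBodyOp

/-! ## Local Hamiltonians -/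

/-- An interaction: self-adjoint terms `h_Z` acting on the sites of `Z`, for every `Z ⊆ Λ`. -/
structure Interaction (Λ : Type) [Fintype Λ] [DecidableEq Λ] (d₀ : ℕ) where
  term : Finset Λ → ManyBodyOp Λ d₀
  isHermitian : ∀ Z, (term Z).IsHermitian
  supportedOn : ∀ Z, ManyBodyOp.SupportedOn Z (term Z)

namespace Interaction

variable {Λ : Type} [Fintype Λ] [DecidableEq Λ] {d₀ : ℕ}

/-- The Hamiltonian `H = ∑_Z h_Z`. -/
def hamiltonian (Φ : Interaction Λ d₀) : ManyBodyOp Λ d₀ :=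
  ∑ Z, Φ.term Z

theorem isHermitian_hamiltonian (Φ : Interaction Λ d₀) : Φ.hamiltonian.IsHermitian := by
  unfold hamiltonian Matrix.IsHermitian
  rw [Matrix.conjTranspose_sum]
  exact Finset.sum_congr rfl fun Z _ => Φ.isHermitian Z

/-- `k`-local, with one-site energy at most `g`, and short-range:
`h_Z = 0` unless `|Z| ≤ k`; `∑_{Z ∋ i} ‖h_Z‖ ≤ g` for every site `i`; and
`∑_{Z ⊇ {i,j}} ‖h_Z‖ ≤ g₀ e^{-μ₀ d_{i,j}}` for every pair of sites. -/
structure IsShortRange (Φ : Interaction Λ d₀) (G : SimpleGraph Λ) (k : ℕ) (g g₀ μ₀ : ℝ) :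
    Prop where
  local_terms : ∀ Z : Finset Λ, k < Z.card → Φ.term Z = 0
  one_site : ∀ i : Λ, ∑ Z with i ∈ Z, ‖Φ.term Z‖ ≤ g
  decay : ∀ i j : Λ, i ≠ j →
    ∑ Z with i ∈ Z ∧ j ∈ Z, ‖Φ.term Z‖ ≤ g₀ * Real.exp (-μ₀ * (G.dist i j : ℝ))

/-- The Lieb-Robinson bound with constants `C`, `v`, `μ`: for operators `O_X`, `O_Y` of unit norm,
supported on sets of sites at distance `R = d_{X,Y} > 0`, and for all times `t`,
`‖[O_X(t), O_Y]‖ ≤ C min(|∂X|, |∂Y|) (e^{v|t|} - 1) e^{-μR}`. -/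
def LiebRobinson (Φ : Interaction Λ d₀) (G : SimpleGraph Λ) (C v μ : ℝ) : Prop :=
  ∀ (X Y : Finset Λ), X.Nonempty → Y.Nonempty → 0 < Lattice.setDist G X Y →
    ∀ (A B : ManyBodyOp Λ d₀), ManyBodyOp.SupportedOn X A → ManyBodyOp.SupportedOn Y B →
      ‖A‖ = 1 → ‖B‖ = 1 → ∀ t : ℝ,
        ‖ManyBodyOp.evolve Φ.hamiltonian t A * B - B * ManyBodyOp.evolve Φ.hamiltonian t A‖ ≤
          C * (min (Lattice.surface G X).card (Lattice.surface G Y).card : ℕ) *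
            (Real.exp (v * |t|) - 1) * Real.exp (-μ * (Lattice.setDist G X Y : ℝ))

/-- The Gibbs state of the Hamiltonian `∑_Z h_Z`. -/
def gibbs (Φ : Interaction Λ d₀) (β : ℝ) : ManyBodyOp Λ d₀ :=
  ManyBodyOp.gibbs Φ.hamiltonian β

theorem isHermitian_gibbs (Φ : Interaction Λ d₀) (β : ℝ) : (Φ.gibbs β).IsHermitian :=
  ManyBodyOp.isHermitian_gibbs Φ.isHermitian_hamiltonian β

end Interaction

/-! ## The constants of the bound -/

namespace SkewBound

/-- `ξ'_β`, given by `1 / ξ'_β = μ / (2 + v β / π)`. -/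
def xi (v μ β : ℝ) : ℝ := (μ / (2 + v * β / Real.pi))⁻¹

/-- `C'_β = (12 + 2C) / π + 4C / (v β)`. -/
def C' (C v β : ℝ) : ℝ := (12 + 2 * C) / Real.pi + 4 * C / (v * β)

/-- `C̃'_β = C'_β [(μ/2)^D + γ e^{μ/2} D!]`. -/
def Ctilde (D : ℕ) (γ C v μ β : ℝ) : ℝ :=
  C' C v β * ((μ / 2) ^ D + γ * Real.exp (μ / 2) * (D.factorial : ℝ))

end SkewBound

end

/-! In an eigenbasis of the Gibbs state, with eigenvalues p = e^{-βE}/Z, symmetrizing in the two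
indices gives the skew information as ½ ∑ (p_s^{1-α} - p_{s'}^{1-α})(p_s^α - p_{s'}^α) K_{ss'}
K_{s's}. This extends to a bilinear form in two operators (`wydForm`), so for a sum of site
operators it suffices that the form of operators at sites i and j decays exponentially in d(i,j);
summing over j then gives a constant per site.

The decay comes from locality in time. The weight above equals (p_s - p_{s'}) F(ω) with ω = E_{s'} -
E_s and F an odd filter bounded by 1 (`rpow_sub_mul_rpow_sub`). The Fourier series of cosh on an
interval expands F into terms w_n ω/((an)² + ω²) with a = 2π/β and w_n ≥ 0 bounded
(`hasSum_filter`). Each of these is the integral of e^{-ant} sin(ωt) over t > 0, and the spectral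
sum of (p_s - p_{s'}) A_{ss'} B_{s's} e^{itω} is tr(ρ[A(-t), B]). Cutting the time integral at b
costs O(e^{-πb/β}). Before b the Lieb-Robinson bound applies; its factor e^{vt} - 1 cancels the 1/t
singularity of ∑ w_n e^{-ant} at t = 0 (`norm_sum_filter_le`). Taking b proportional to the distance
makes both contributions at most a multiple of e^{-d/ξ'_β}.

The Fisher information reduces to the same form at α = 1/2 for the pair K, K†, because (p - q)²/(p +
q) ≤ 2(√p - √q)².

The Lieb-Robinson bound rests on one estimate (`norm_commutator_le_of_crossing`): the commutator of
A(t) with B grows only through the Hamiltonian terms that cross the surface of the support of A.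
Iterating it over supports of at most k sites gives a bound for every local term
(`norm_commutator_local_le`). One more application to an arbitrary X, with the crossing terms summed
by their distance to the surface, produces the factor |∂X|. -/

noncomputable section

/-! ### Expansion of the spectral filter and its truncation in time -/

namespace SpectralFilter

open Real

/-- Splitting cosh into two exponentials makes the integrand elementary; since e^{2πin} = 1, the
boundary values do not depend on n, and the two denominators multiply to 4(x² + (nπ)²). -/
theorem integral_fourier_mul_cosh {x : ℝ} (hx : x ≠ 0) (n : ℤ) :
    fourierCoeffOn (zero_lt_one' ℝ) (fun y : ℝ => (Real.cosh ((1 - 2 * y) * x) : ℂ)) n =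
      ((x * Real.sinh x / (x ^ 2 + (n * π) ^ 2) : ℝ) : ℂ) := by
  rw [fourierCoeffOn_eq_integral]
  have h1 : (2 * x + 2 * π * n * Complex.I : ℂ) ≠ 0 := by
    intro h
    have := congrArg Complex.re h
    simp at this
    exact hx this
  have h2 : (2 * x - 2 * π * n * Complex.I : ℂ) ≠ 0 := by
    intro h
    have := congrArg Complex.re h
    simp at this
    exact hx this
  have hn : Complex.exp (2 * π * n * Complex.I) = 1 := by
    rw [show (2 * π * n * Complex.I : ℂ) = n * (2 * π * Complex.I) by ring]
    exact Complex.exp_int_mul_two_pi_mul_I n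
  have key : ∀ y : ℝ, HasDerivAt (fun y : ℝ =>
      (-(Complex.exp (x - (2 * x + 2 * π * n * Complex.I) * y) /
        (2 * (2 * x + 2 * π * n * Complex.I))) +
       Complex.exp (-x + (2 * x - 2 * π * n * Complex.I) * y) /
        (2 * (2 * x - 2 * π * n * Complex.I)) : ℂ))
      (fourier (-n) (y : AddCircle ((1 : ℝ) - 0)) • (Real.cosh ((1 - 2 * y) * x) : ℂ)) y := by
    intro y
    have hy : HasDerivAt (fun y : ℝ => (y : ℂ)) 1 y := Complex.ofRealCLM.hasDerivAt
    have e1 := (((hy.const_mul (2 * x + 2 * π * n * Complex.I : ℂ)).const_sub (x : ℂ)).cexp.div_const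
      (2 * (2 * x + 2 * π * n * Complex.I))).neg
    have e2 := ((hy.const_mul (2 * x - 2 * π * n * Complex.I : ℂ)).const_add (-x : ℂ)).cexp.div_const
      (2 * (2 * x - 2 * π * n * Complex.I))
    refine (e1.add e2).congr_deriv ?_
    rw [fourier_coe_apply, Complex.ofReal_cosh, Complex.cosh, smul_eq_mul]
    have a1 : ∀ z w : ℂ, z ≠ 0 → -(w * -(z * 1) / (2 * z)) = w / 2 := by
      intro z w hz; field_simp
    have a2 : ∀ z w : ℂ, z ≠ 0 → w * (z * 1) / (2 * z) = w / 2 := by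
      intro z w hz; field_simp
    rw [a1 _ _ h1, a2 _ _ h2, mul_div_assoc', mul_add, ← Complex.exp_add, ← Complex.exp_add,
      ← add_div]
    push_cast
    congr 3 <;> ring
  rw [intervalIntegral.integral_eq_sub_of_hasDerivAt (fun y _ => key y)
    (Continuous.intervalIntegrable (by fun_prop) _ _)]
  have e1 : Complex.exp (x - (2 * x + 2 * π * n * Complex.I) * (1 : ℝ)) = Complex.exp (-x) := by
    rw [show (x - (2 * x + 2 * π * n * Complex.I) * (1 : ℝ) : ℂ) =
      -x - (2 * π * n * Complex.I) by push_cast; ring, Complex.exp_sub, hn, div_one]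
  have e2 : Complex.exp (-x + (2 * x - 2 * π * n * Complex.I) * (1 : ℝ)) = Complex.exp x := by
    rw [show (-x + (2 * x - 2 * π * n * Complex.I) * (1 : ℝ) : ℂ) =
      x - (2 * π * n * Complex.I) by push_cast; ring, Complex.exp_sub, hn, div_one]
  rw [e1, e2]
  have h3 : ((x ^ 2 + (n * π) ^ 2 : ℝ) : ℂ) ≠ 0 := by
    have : 0 < x ^ 2 + (n * π) ^ 2 := by positivity
    exact_mod_cast this.ne'
  have h4 : (2 * x + 2 * π * n * Complex.I : ℂ) * (2 * x - 2 * π * n * Complex.I) =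
      4 * ((x ^ 2 + (n * π) ^ 2 : ℝ) : ℂ) := by
    push_cast
    ring_nf
    rw [Complex.I_sq]
    ring
  rw [Complex.ofReal_div, Complex.ofReal_mul, Complex.ofReal_sinh, Complex.sinh, eq_div_iff h3]
  have h5 : ((x ^ 2 + (n * π) ^ 2 : ℝ) : ℂ) =
      (2 * x + 2 * π * n * Complex.I : ℂ) * (2 * x - 2 * π * n * Complex.I) / 4 := by
    rw [h4]; ring
  rw [h5]
  simp only [Complex.ofReal_zero, mul_zero, sub_zero, add_zero, Complex.real_smul]
  have hpq : (2 * x + 2 * π * n * Complex.I : ℂ) + (2 * x - 2 * π * n * Complex.I) = 4 * x := by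
    ring
  generalize (2 * x + 2 * π * n * Complex.I : ℂ) = p at *
  generalize (2 * x - 2 * π * n * Complex.I : ℂ) = q at *
  field_simp
  push_cast
  linear_combination (Complex.exp x - Complex.exp (-x)) * hpq

theorem hasSum_cosh_fourier {x : ℝ} (hx : x ≠ 0) {y : ℝ} (hy : y ∈ Set.Ico (0 : ℝ) 1) :
    HasSum (fun n : ℤ => ((x * Real.sinh x / (x ^ 2 + (n * π) ^ 2) : ℝ) : ℂ) *
      Complex.exp (2 * π * Complex.I * n * y)) (Real.cosh ((1 - 2 * y) * x) : ℂ) := by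
  let φ : ℝ → ℂ := fun y => (Real.cosh ((1 - 2 * y) * x) : ℂ)
  have hφ : Continuous (AddCircle.liftIco 1 0 φ) := by
    -- The periodic extension is continuous because cosh is even: the values at 0 and 1 are cosh x
    -- and cosh(-x).
    refine AddCircle.liftIco_zero_continuous ?_ (Continuous.continuousOn (by fun_prop))
    simp only [φ]
    rw [← Real.cosh_neg]
    norm_num
  let B : C(AddCircle (1 : ℝ), ℂ) := ⟨AddCircle.liftIco 1 0 φ, hφ⟩
  have step1 : ∀ n : ℤ, fourierCoeff B n =
      ((x * Real.sinh x / (x ^ 2 + (n * π) ^ 2) : ℝ) : ℂ) := by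
    intro n
    rw [ContinuousMap.coe_mk, fourierCoeff_liftIco_eq, ← integral_fourier_mul_cosh hx n]
    simp only [zero_add]
    rfl
  have hs : Summable fun n : ℤ => ((x * Real.sinh x / (x ^ 2 + (n * π) ^ 2) : ℝ) : ℂ) := by
    rw [Complex.summable_ofReal]
    have h2 : Summable fun n : ℤ => |x * Real.sinh x| / π ^ 2 * (1 / (n : ℝ) ^ 2) :=
      ((Real.summable_one_div_int_pow (p := 2)).mpr (by norm_num)).mul_left _
    refine Summable.of_norm_bounded_eventually h2 ?_
    filter_upwards [(Set.finite_singleton (0 : ℤ)).compl_mem_cofinite] with n hn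
    have hn : (n : ℝ) ≠ 0 := by exact_mod_cast hn
    have hp : 0 < ((n : ℝ) * π) ^ 2 := by positivity
    rw [Real.norm_eq_abs, abs_div, abs_of_nonneg (by positivity : 0 ≤ x ^ 2 + (n * π) ^ 2),
      div_mul_div_comm, mul_one]
    gcongr
    rw [mul_pow] at hp ⊢
    nlinarith [sq_nonneg x]
  have h := has_pointwise_sum_fourier_series_of_summable (f := B)
    (hs.congr fun n => (step1 n).symm) (y : AddCircle (1 : ℝ))
  simp_rw [step1] at h
  convert h using 1
  · ext n
    rw [smul_eq_mul, fourier_coe_apply]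
    simp
  · change φ y = AddCircle.liftIco 1 0 φ y
    rw [AddCircle.liftIco_coe_apply (by simpa using hy)]

/-- This is the difference of the cosh series at y = 0 and y = α, by cosh x - cosh((1 - 2α)x) = 2
sinh((1 - α)x) sinh(αx), with the indices n and -n paired. -/
theorem hasSum_sinh_mul_sinh (x : ℝ) {α : ℝ} (h0 : 0 ≤ α) (h1 : α ≤ 1) :
    HasSum (fun n : ℕ => 2 * (x * Real.sinh x / (x ^ 2 + (n * π) ^ 2)) *
      (1 - Real.cos (2 * π * n * α))) (2 * Real.sinh ((1 - α) * x) * Real.sinh (α * x)) := by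
  rcases eq_or_ne x 0 with rfl | hx
  · simp
  -- The series is available on [0, 1) only; at α = 1 both sides vanish.
  rcases h1.eq_or_lt with rfl | h1
  · have : ∀ n : ℕ, Real.cos (2 * π * n) = 1 := fun n => by
      rw [mul_comm (2 * π)]; exact Real.cos_nat_mul_two_pi n
    simp [this]
  have e := (hasSum_cosh_fourier hx (y := 0) ⟨le_rfl, zero_lt_one⟩).sub
    (hasSum_cosh_fourier hx (y := α) ⟨h0, h1⟩)
  -- Pairing counts n = 0 twice, which is harmless because that term is zero in the difference.
  have e := (Complex.hasSum_re e).nat_add_neg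
  convert e using 1
  · ext n
    have : ∀ m : ℤ, (Complex.exp (2 * π * Complex.I * m * α)).re = Real.cos (2 * π * m * α) := by
      intro m
      rw [show (2 * π * Complex.I * m * α : ℂ) = ((2 * π * m * α : ℝ) : ℂ) * Complex.I by
        push_cast; ring, Complex.exp_ofReal_mul_I_re]
    simp only [Complex.ofReal_zero, mul_zero, Complex.exp_zero, Complex.sub_re,
      Complex.re_ofReal_mul, this, Complex.one_re]
    push_cast
    rw [show 2 * π * -(n : ℝ) * α = -(2 * π * n * α) by ring, Real.cos_neg]
    ring
  · simp only [Complex.ofReal_zero, mul_zero, Complex.exp_zero, Complex.sub_re,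
      Complex.ofReal_re, Int.cast_zero, zero_mul, sub_self, Complex.zero_re, add_zero, sub_zero,
      one_mul]
    rw [show x = (1 - α) * x + α * x by ring, show (1 - 2 * α) * ((1 - α) * x + α * x) =
      (1 - α) * x - α * x by ring, Real.cosh_add, Real.cosh_sub]
    ring_nf

/-- The quotient is e^{-y/2} (y/2)/sinh(y/2), and sinh u ≥ u for u ≥ 0. -/
theorem div_exp_sub_one_le {y : ℝ} (hy : 0 < y) : y / (Real.exp y - 1) ≤ Real.exp (-(y / 2)) := by
  have h1 : y / 2 ≤ Real.sinh (y / 2) := Real.self_le_sinh_iff.2 (by positivity)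
  rw [Real.sinh_eq] at h1
  have h2 : Real.exp y = Real.exp (y / 2) * Real.exp (y / 2) := by rw [← Real.exp_add]; ring_nf
  have h3 : Real.exp (-(y / 2)) * Real.exp (y / 2) = 1 := by rw [← Real.exp_add]; simp
  have h4 : 0 < Real.exp y - 1 := by have := Real.add_one_lt_exp hy.ne'; linarith
  rw [div_le_iff₀ h4, h2, mul_sub, ← mul_assoc, h3]
  linarith

theorem hasDerivAt_exp_mul_sin_cos (l ω t : ℝ) (h : 0 < l) :
    HasDerivAt (fun t => -(Real.exp (-(l * t)) * (l * Real.sin (ω * t) + ω * Real.cos (ω * t)) /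
      (l ^ 2 + ω ^ 2))) (Real.exp (-(l * t)) * Real.sin (ω * t)) t := by
  have hl : HasDerivAt (fun t => Real.exp (-(l * t))) (Real.exp (-(l * t)) * -(l * 1)) t :=
    (((hasDerivAt_id t).const_mul l).neg).exp
  have hs := (((hasDerivAt_id t).const_mul ω).sin.const_mul l)
  have hc := (((hasDerivAt_id t).const_mul ω).cos.const_mul ω)
  refine ((hl.mul (hs.add hc)).div_const (l ^ 2 + ω ^ 2)).neg.congr_deriv ?_
  have : l ^ 2 + ω ^ 2 ≠ 0 := by positivity
  simp only [id, Pi.add_apply]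
  field_simp
  ring

theorem lorentz_eq_integral (l ω b : ℝ) (h : 0 < l) :
    ω / (l ^ 2 + ω ^ 2) = (∫ t in (0 : ℝ)..b, Real.exp (-(l * t)) * Real.sin (ω * t)) +
      Real.exp (-(l * b)) * (l * Real.sin (ω * b) + ω * Real.cos (ω * b)) / (l ^ 2 + ω ^ 2) := by
  rw [intervalIntegral.integral_eq_sub_of_hasDerivAt
    (fun t _ => hasDerivAt_exp_mul_sin_cos l ω t h)
    (Continuous.intervalIntegrable (by fun_prop) _ _)]
  simp

/-- Geometric series. The vanishing of `w 0` is essential: the term n = 0 would not decay in t. -/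
theorem sum_weight_exp_le {a t : ℝ} (ha : 0 < a) (ht : 0 < t) {w : ℕ → ℝ} (hw0 : w 0 = 0)
    (hw : ∀ n, w n ≤ 4 * a / π) (N : ℕ) :
    ∑ n ∈ Finset.range N, w n * Real.exp (-(a * n * t)) ≤
      4 / (π * t) * Real.exp (-(a * t / 2)) := by
  have hq0 : 0 < Real.exp (-(a * t)) := Real.exp_pos _
  have hq1 : Real.exp (-(a * t)) < 1 := by
    rw [Real.exp_lt_one_iff]; have := mul_pos ha ht; linarith
  have hat : 0 < a * t := mul_pos ha ht
  have h0 : 0 ≤ 4 / (π * t) * Real.exp (-(a * t / 2)) := by positivity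
  rcases N with _ | N
  · simpa using h0
  rw [Finset.sum_range_succ', hw0, zero_mul, add_zero]
  have h1 : ∀ n : ℕ, Real.exp (-(a * ((n + 1 : ℕ) : ℝ) * t)) =
      Real.exp (-(a * t)) * Real.exp (-(a * t)) ^ n := by
    intro n
    rw [← pow_succ', ← Real.exp_nat_mul]
    ring_nf
  have h2 : ∑ n ∈ Finset.range N, Real.exp (-(a * t)) ^ n ≤ (1 - Real.exp (-(a * t)))⁻¹ := by
    rw [← one_div, le_div_iff₀ (by linarith), mul_comm, mul_neg_geom_sum]
    have := pow_pos hq0 N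
    linarith
  calc ∑ n ∈ Finset.range N, w (n + 1) * Real.exp (-(a * ((n + 1 : ℕ) : ℝ) * t))
      ≤ ∑ n ∈ Finset.range N, 4 * a / π * (Real.exp (-(a * t)) * Real.exp (-(a * t)) ^ n) := by
        refine Finset.sum_le_sum fun n _ => ?_
        rw [h1]
        exact mul_le_mul_of_nonneg_right (hw _) (by positivity)
    _ = 4 * a / π * Real.exp (-(a * t)) * ∑ n ∈ Finset.range N, Real.exp (-(a * t)) ^ n := by
        rw [← Finset.mul_sum, ← Finset.mul_sum, mul_assoc]
    _ ≤ 4 * a / π * Real.exp (-(a * t)) * (1 - Real.exp (-(a * t)))⁻¹ := by gcongr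
    _ = 4 / (π * t) * (a * t / (Real.exp (a * t) - 1)) := by
        rw [Real.exp_neg]
        have : Real.exp (a * t) - 1 ≠ 0 := by have := Real.add_one_lt_exp hat.ne'; linarith
        have h' : 1 - (Real.exp (a * t))⁻¹ ≠ 0 := by rw [← Real.exp_neg]; linarith
        field_simp
    _ ≤ _ := by
        gcongr
        exact div_exp_sub_one_le hat

/-- The boundary terms at time b of the truncated sine transforms. In the sine part, |sin ωb| ≤ |ω|b
and an|ω| ≤ ((an)² + ω²)/2 leave (b/2) ∑ w_n e^{-anb}, which accounts for 2/π; in the cosine part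
the partial sums of the expansion of G itself account for 1. -/
theorem abs_remainder_le {a b ω G : ℝ} (ha : 0 < a) (hb : 0 < b) {w : ℕ → ℝ} (hw0 : w 0 = 0)
    (hwn : ∀ n, 0 ≤ w n) (hw : ∀ n, w n ≤ 4 * a / π)
    (hG : HasSum (fun n : ℕ => w n * (ω / ((a * n) ^ 2 + ω ^ 2))) G) (hG1 : |G| ≤ 1) (N : ℕ) :
    |∑ n ∈ Finset.range N, w n * (Real.exp (-(a * n * b)) *
      (a * n * Real.sin (ω * b) + ω * Real.cos (ω * b)) / ((a * n) ^ 2 + ω ^ 2))| ≤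
      (1 + 2 / π) * Real.exp (-(a * b / 2)) := by
  -- All terms of the expansion have the sign of ω, so partial sums of absolute values are bounded
  -- by |G| ≤ 1.
  have hpart : ∑ n ∈ Finset.range N, w n * (|ω| / ((a * n) ^ 2 + ω ^ 2)) ≤ 1 := by
    rcases le_total 0 ω with h | h
    · rw [abs_of_nonneg h]
      refine (sum_le_hasSum _ (fun n _ => ?_) hG).trans ((le_abs_self _).trans hG1)
      exact mul_nonneg (hwn n) (by positivity)
    · rw [abs_of_nonpos h]
      have hG' := hG.neg
      refine le_trans ?_ ((sum_le_hasSum (Finset.range N) (fun n _ => ?_) hG').trans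
        ((neg_le_abs _).trans hG1))
      · exact le_of_eq (Finset.sum_congr rfl fun n _ => by ring)
      · rw [← mul_neg, ← neg_div]
        exact mul_nonneg (hwn n) (div_nonneg (by linarith) (by positivity))
  have hterm : ∀ n : ℕ, |w n * (Real.exp (-(a * n * b)) *
      (a * n * Real.sin (ω * b) + ω * Real.cos (ω * b)) / ((a * n) ^ 2 + ω ^ 2))| ≤
      b / 2 * (w n * Real.exp (-(a * n * b))) +
        Real.exp (-(a * b / 2)) * (w n * (|ω| / ((a * n) ^ 2 + ω ^ 2))) := by
    intro n
    rcases Nat.eq_zero_or_pos n with rfl | hn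
    · simp [hw0]
    have hn1 : (1 : ℝ) ≤ n := by exact_mod_cast hn
    have hden : 0 < (a * n) ^ 2 + ω ^ 2 := by positivity
    have hs : |Real.sin (ω * b)| ≤ |ω| * b := by
      calc _ ≤ |ω * b| := Real.abs_sin_le_abs
        _ = _ := by rw [abs_mul, abs_of_pos hb]
    have hnum : |a * n * Real.sin (ω * b) + ω * Real.cos (ω * b)| ≤
        a * n * (|ω| * b) + |ω| := by
      refine (abs_add_le _ _).trans (add_le_add ?_ ?_)
      · rw [abs_mul, abs_of_nonneg (by positivity : 0 ≤ a * n)]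
        gcongr
      · rw [abs_mul]
        exact mul_le_of_le_one_right (abs_nonneg _) (Real.abs_cos_le_one _)
    have hamgm : a * n * (|ω| * b) / ((a * n) ^ 2 + ω ^ 2) ≤ b / 2 := by
      rw [div_le_iff₀ hden, ← sq_abs ω]
      nlinarith [mul_nonneg hb.le (sq_nonneg (a * n - |ω|))]
    have hexp : Real.exp (-(a * n * b)) ≤ Real.exp (-(a * b / 2)) := by
      rw [Real.exp_le_exp]
      have : a * b ≤ a * n * b := by
        rw [mul_assoc, mul_comm (n : ℝ), ← mul_assoc]
        exact le_mul_of_one_le_right (by positivity) hn1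
      have := mul_pos ha hb
      linarith
    rw [abs_mul, abs_div, abs_mul, abs_of_nonneg (hwn n), abs_of_pos (Real.exp_pos _),
      abs_of_pos hden]
    calc w n * (Real.exp (-(a * n * b)) *
          |a * n * Real.sin (ω * b) + ω * Real.cos (ω * b)| / ((a * n) ^ 2 + ω ^ 2))
        ≤ w n * (Real.exp (-(a * n * b)) * (a * n * (|ω| * b) + |ω|) /
          ((a * n) ^ 2 + ω ^ 2)) := by
          have := hwn n
          gcongr
      _ = (a * n * (|ω| * b) / ((a * n) ^ 2 + ω ^ 2)) * (w n * Real.exp (-(a * n * b))) +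
          Real.exp (-(a * n * b)) * (w n * (|ω| / ((a * n) ^ 2 + ω ^ 2))) := by ring
      _ ≤ _ := by
          have := hwn n
          gcongr
  refine (Finset.abs_sum_le_sum_abs _ _).trans ((Finset.sum_le_sum fun n _ => hterm n).trans ?_)
  rw [Finset.sum_add_distrib, ← Finset.mul_sum, ← Finset.mul_sum]
  have h1 := sum_weight_exp_le ha hb hw0 hw N
  calc _ ≤ b / 2 * (4 / (π * b) * Real.exp (-(a * b / 2))) + Real.exp (-(a * b / 2)) * 1 := by
        gcongr
    _ = _ := by field_simp; ring

/-- An estimate of a spectral sum with the filter function `∑ₙ wₙ ω / ((a n)² + ω²)` by its sine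
transforms at times up to `b`. -/
theorem norm_sum_filter_le {κ : Type*} [Fintype κ] (m : κ → ℂ) (ω G : κ → ℝ) {a b c v M : ℝ}
    (ha : 0 < a) (hb : 0 < b) (hc : 0 ≤ c) (hv : 0 < v) (hM : ∑ k, ‖m k‖ ≤ M)
    (hT : ∀ t : ℝ, 0 < t → t ≤ b →
      ‖∑ k, m k * (Real.sin (ω k * t) : ℂ)‖ ≤ c * (Real.exp (v * t) - 1))
    {w : ℕ → ℝ} (hw0 : w 0 = 0) (hwn : ∀ n, 0 ≤ w n) (hw : ∀ n, w n ≤ 4 * a / π)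
    (hG : ∀ k, HasSum (fun n : ℕ => w n * (ω k / ((a * n) ^ 2 + ω k ^ 2))) (G k))
    (hG1 : ∀ k, |G k| ≤ 1) :
    ‖∑ k, m k * (G k : ℂ)‖ ≤
      M * ((1 + 2 / π) * Real.exp (-(a * b / 2))) + 4 / π * c * (Real.exp (v * b) - 1) := by
  -- All estimates are made for partial sums, uniformly in N, so that no infinite sum is exchanged
  -- with the integral.
  have hlim : Filter.Tendsto (fun N : ℕ => ‖∑ k, m k *
      ((∑ n ∈ Finset.range N, w n * (ω k / ((a * n) ^ 2 + ω k ^ 2)) : ℝ) : ℂ)‖)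
      Filter.atTop (nhds ‖∑ k, m k * (G k : ℂ)‖) := by
    refine (tendsto_finsetSum _ fun k _ => Filter.Tendsto.const_mul _ ?_).norm
    exact (Complex.continuous_ofReal.tendsto _).comp (hG k).tendsto_sum_nat
  refine le_of_tendsto' hlim fun N => ?_
  set f : ℝ → ℝ := fun t => ∑ n ∈ Finset.range N, w n * Real.exp (-(a * n * t)) with hf
  set r : κ → ℝ := fun k => ∑ n ∈ Finset.range N, w n * (Real.exp (-(a * n * b)) *
      (a * n * Real.sin (ω k * b) + ω k * Real.cos (ω k * b)) / ((a * n) ^ 2 + ω k ^ 2)) with hr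
  have hsplit : ∀ k, ∑ n ∈ Finset.range N, w n * (ω k / ((a * n) ^ 2 + ω k ^ 2)) =
      (∫ t in (0 : ℝ)..b, f t * Real.sin (ω k * t)) + r k := by
    intro k
    have : ∀ n : ℕ, w n * (ω k / ((a * n) ^ 2 + ω k ^ 2)) =
        (∫ t in (0 : ℝ)..b, w n * Real.exp (-(a * n * t)) * Real.sin (ω k * t)) +
        w n * (Real.exp (-(a * n * b)) *
          (a * n * Real.sin (ω k * b) + ω k * Real.cos (ω k * b)) / ((a * n) ^ 2 + ω k ^ 2)) := by
      intro n
      rcases Nat.eq_zero_or_pos n with rfl | hn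
      · simp [hw0]
      · have hn1 : (0 : ℝ) < n := by exact_mod_cast hn
        rw [lorentz_eq_integral (a * n) (ω k) b (by positivity), mul_add,
          ← intervalIntegral.integral_const_mul]
        simp only [mul_assoc]
    simp only [this, hr, hf, Finset.sum_add_distrib, Finset.sum_mul]
    rw [intervalIntegral.integral_finsetSum]
    intro n _
    exact Continuous.intervalIntegrable (by fun_prop) _ _
  have hint : ∑ k, m k * ((∫ t in (0 : ℝ)..b, f t * Real.sin (ω k * t) : ℝ) : ℂ) =
      ∫ t in (0 : ℝ)..b, (f t : ℂ) * ∑ k, m k * (Real.sin (ω k * t) : ℂ) := by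
    simp only [Finset.mul_sum]
    rw [intervalIntegral.integral_finsetSum
      (fun k _ => Continuous.intervalIntegrable (by fun_prop) _ _)]
    refine Finset.sum_congr rfl fun k _ => ?_
    rw [← intervalIntegral.integral_ofReal, ← intervalIntegral.integral_const_mul]
    refine intervalIntegral.integral_congr fun t _ => ?_
    push_cast
    ring
  have hF : ∫ t in (0 : ℝ)..b, 4 / π * c * (v * Real.exp (v * t)) =
      4 / π * c * (Real.exp (v * b) - 1) := by
    have : ∀ t : ℝ, HasDerivAt (fun t => 4 / π * c * Real.exp (v * t))
        (4 / π * c * (v * Real.exp (v * t))) t := by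
      intro t
      refine ((((hasDerivAt_id t).const_mul v).exp).const_mul (4 / π * c)).congr_deriv ?_
      simp only [id]; ring
    rw [intervalIntegral.integral_eq_sub_of_hasDerivAt (fun t _ => this t)
      (Continuous.intervalIntegrable (by fun_prop) _ _)]
    simp; ring
  have hmain : ‖∫ t in (0 : ℝ)..b, (f t : ℂ) * ∑ k, m k * (Real.sin (ω k * t) : ℂ)‖ ≤
      4 / π * c * (Real.exp (v * b) - 1) := by
    rw [← hF]
    refine intervalIntegral.norm_integral_le_of_norm_le hb.le ?_
      (Continuous.intervalIntegrable (by fun_prop) _ _)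
    refine Filter.Eventually.of_forall fun t ht => ?_
    have hf0 : 0 ≤ f t := Finset.sum_nonneg fun n _ => mul_nonneg (hwn n) (Real.exp_pos _).le
    have hft : f t ≤ 4 / (π * t) := by
      refine (sum_weight_exp_le ha ht.1 hw0 hw N).trans (mul_le_of_le_one_right ?_ ?_)
      · have := ht.1; positivity
      · rw [Real.exp_le_one_iff]; have := mul_pos ha ht.1; linarith
    -- This factor t cancels the singularity of f, and what remains, v e^{vt}, integrates exactly to
    -- e^{vb} - 1.
    have hconv : Real.exp (v * t) - 1 ≤ v * t * Real.exp (v * t) := by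
      have h1 := Real.add_one_le_exp (-(v * t))
      have h2 : Real.exp (-(v * t)) * Real.exp (v * t) = 1 := by rw [← Real.exp_add]; simp
      nlinarith [Real.exp_pos (v * t)]
    rw [norm_mul, Complex.norm_real, Real.norm_of_nonneg hf0]
    have ht0 := ht.1
    calc f t * ‖∑ k, m k * (Real.sin (ω k * t) : ℂ)‖
        ≤ 4 / (π * t) * (c * (v * t * Real.exp (v * t))) := by
          gcongr
          exact (hT t ht.1 ht.2).trans (by gcongr)
      _ = _ := by field_simp
  have hrem : ‖∑ k, m k * (r k : ℂ)‖ ≤ M * ((1 + 2 / π) * Real.exp (-(a * b / 2))) := by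
    refine (norm_sum_le _ _).trans ?_
    refine le_trans ?_ (mul_le_mul_of_nonneg_right hM (by positivity))
    rw [Finset.sum_mul]
    refine Finset.sum_le_sum fun k _ => ?_
    rw [norm_mul, Complex.norm_real, Real.norm_eq_abs]
    gcongr
    exact abs_remainder_le ha hb hw0 hwn hw (hG k) (hG1 k) N
  simp only [hsplit, Complex.ofReal_add, mul_add, Finset.sum_add_distrib]
  rw [hint, add_comm]
  exact (norm_add_le _ _).trans (add_le_add hrem hmain)

/-- The odd filter `2 sinh ((1 - α) x) sinh (α x) / sinh x`. -/
def filter (α x : ℝ) : ℝ := 2 * Real.sinh ((1 - α) * x) * Real.sinh (α * x) / Real.sinh x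

theorem filter_neg (α x : ℝ) : filter α (-x) = -filter α x := by
  simp only [filter, mul_neg, Real.sinh_neg, neg_mul, neg_neg, div_neg]

/-- For x > 0 the numerator is cosh x - cosh((1 - 2α)x) ≤ cosh x - 1 ≤ sinh x, as cosh x - sinh x =
e^{-x} ≤ 1. -/
theorem abs_filter_le_one {α : ℝ} (h0 : 0 ≤ α) (h1 : α ≤ 1) (x : ℝ) : |filter α x| ≤ 1 := by
  suffices h : ∀ x : ℝ, 0 < x → |filter α x| ≤ 1 by
    rcases lt_trichotomy x 0 with hx | rfl | hx
    · have := h (-x) (by linarith)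
      rwa [filter_neg, abs_neg] at this
    · simp [filter]
    · exact h x hx
  intro x hx
  have hs : 0 < Real.sinh x := Real.sinh_pos_iff.2 hx
  have hA : 0 ≤ Real.sinh ((1 - α) * x) :=
    Real.sinh_nonneg_iff.2 (mul_nonneg (by linarith) hx.le)
  have hB : 0 ≤ Real.sinh (α * x) := Real.sinh_nonneg_iff.2 (mul_nonneg h0 hx.le)
  rw [filter, abs_of_nonneg (by positivity), div_le_one hs]
  have e1 : 2 * Real.sinh ((1 - α) * x) * Real.sinh (α * x) =
      Real.cosh x - Real.cosh ((1 - α) * x - α * x) := by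
    rw [Real.cosh_sub, show x = (1 - α) * x + α * x by ring, Real.cosh_add]
    ring_nf
  have e2 := Real.one_le_cosh ((1 - α) * x - α * x)
  have e3 : Real.cosh x - Real.sinh x ≤ 1 := by
    rw [Real.cosh_sub_sinh, Real.exp_le_one_iff]; linarith
  linarith

/-- The weights of the expansion of the filter into Lorentz-type terms. -/
def weight (β α : ℝ) (n : ℕ) : ℝ := 2 * (2 * π / β) / π * (1 - Real.cos (2 * π * n * α))

theorem weight_zero (β α : ℝ) : weight β α 0 = 0 := by simp [weight]

theorem weight_nonneg {β : ℝ} (hβ : 0 < β) (α : ℝ) (n : ℕ) : 0 ≤ weight β α n :=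
  mul_nonneg (by positivity) (by linarith [Real.cos_le_one (2 * π * n * α)])

theorem weight_le {β : ℝ} (hβ : 0 < β) (α : ℝ) (n : ℕ) :
    weight β α n ≤ 4 * (2 * π / β) / π := by
  rw [weight, show 4 * (2 * π / β) / π = 2 * (2 * π / β) / π * 2 by ring]
  gcongr
  linarith [Real.neg_one_le_cos (2 * π * n * α)]

theorem hasSum_filter {β α : ℝ} (hβ : 0 < β) (h0 : 0 ≤ α) (h1 : α ≤ 1) (ω : ℝ) :
    HasSum (fun n : ℕ => weight β α n * (ω / ((2 * π / β * n) ^ 2 + ω ^ 2)))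
      (filter α (β * ω / 2)) := by
  rcases eq_or_ne ω 0 with rfl | hω
  -- At ω = 0 the convention 0/0 = 0 gives the filter the value 0, consistent with the series.
  · simp [filter]
  have hs : Real.sinh (β * ω / 2) ≠ 0 := by
    rw [Ne, Real.sinh_eq_zero]; positivity
  have hterm : ∀ n : ℕ, weight β α n * (ω / ((2 * π / β * n) ^ 2 + ω ^ 2)) =
      2 * (β * ω / 2 * Real.sinh (β * ω / 2) / ((β * ω / 2) ^ 2 + (n * π) ^ 2)) *
        (1 - Real.cos (2 * π * n * α)) / Real.sinh (β * ω / 2) := by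
    intro n
    simp only [weight]
    have h3 : (2 * π / β * n) ^ 2 + ω ^ 2 ≠ 0 := by positivity
    have h4 : (β * ω / 2) ^ 2 + (n * π) ^ 2 ≠ 0 := by positivity
    field_simp
    ring
  simp only [hterm]
  exact (hasSum_sinh_mul_sinh (β * ω / 2) h0 h1).div_const (Real.sinh (β * ω / 2))

/-- Around the midpoint y of the two exponents, each difference of s-th powers is 2 e^{(y - log Z)s}
sinh(sx). The prefactors for s = 1 - α and s = α multiply to that for s = 1, so the ratio is a
function of the energy difference alone. -/
theorem rpow_sub_mul_rpow_sub {β α : ℝ} (hβ : 0 < β) {Z : ℝ} (hZ : 0 < Z) (e e' : ℝ) :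
    ((Real.exp (-β * e) / Z) ^ (1 - α) - (Real.exp (-β * e') / Z) ^ (1 - α)) *
      ((Real.exp (-β * e) / Z) ^ α - (Real.exp (-β * e') / Z) ^ α) =
    (Real.exp (-β * e) / Z - Real.exp (-β * e') / Z) * filter α (β * (e' - e) / 2) := by
  rcases eq_or_ne e e' with rfl | hne
  · simp
  set x := β * (e' - e) / 2 with hx
  have hx0 : x ≠ 0 := by
    have : e' - e ≠ 0 := sub_ne_zero.2 hne.symm
    positivity
  have hs : Real.sinh x ≠ 0 := by rwa [Ne, Real.sinh_eq_zero]
  obtain ⟨y, hy⟩ : ∃ y, y = -β * (e + e') / 2 := ⟨_, rfl⟩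
  have h1 : -β * e = y + x := by rw [hy, hx]; ring
  have h2 : -β * e' = y - x := by rw [hy, hx]; ring
  have hZl : Z = Real.exp (Real.log Z) := (Real.exp_log hZ).symm
  rw [h1, h2, hZl]
  generalize Real.log Z = l
  simp only [← Real.exp_sub, ← Real.exp_mul]
  have key : ∀ s : ℝ, Real.exp ((y + x - l) * s) - Real.exp ((y - x - l) * s) =
      2 * Real.exp ((y - l) * s) * Real.sinh (s * x) := by
    intro s
    rw [Real.sinh_eq, show (y + x - l) * s = (y - l) * s + s * x by ring,
      show (y - x - l) * s = (y - l) * s + -(s * x) by ring, Real.exp_add, Real.exp_add]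
    ring
  have k1 := key 1
  rw [mul_one, mul_one, mul_one, one_mul] at k1
  rw [key, key, k1, filter]
  have : Real.exp (y - l) = Real.exp ((y - l) * (1 - α)) * Real.exp ((y - l) * α) := by
    rw [← Real.exp_add]; ring_nf
  rw [this]
  field_simp

end SpectralFilter
end

/-! ### Lattice geometry and sums of exponentials of distances -/

noncomputable section

namespace Lattice

section

variable {Λ : Type}

theorem setDist_comm (G : SimpleGraph Λ) (X Y : Finset Λ) : setDist G X Y = setDist G Y X := by
  unfold setDist
  congr 1
  ext m
  constructor
  · rintro ⟨x, hx, y, hy, h⟩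
    exact ⟨y, hy, x, hx, by rw [SimpleGraph.dist_comm, h]⟩
  · rintro ⟨x, hx, y, hy, h⟩
    exact ⟨y, hy, x, hx, by rw [SimpleGraph.dist_comm, h]⟩

theorem setDist_le {G : SimpleGraph Λ} {X Y : Finset Λ} {x y : Λ} (hx : x ∈ X) (hy : y ∈ Y) :
    setDist G X Y ≤ G.dist x y :=
  Nat.sInf_le ⟨x, hx, y, hy, rfl⟩

theorem exists_setDist_eq (G : SimpleGraph Λ) {X Y : Finset Λ} (hX : X.Nonempty)
    (hY : Y.Nonempty) : ∃ x ∈ X, ∃ y ∈ Y, G.dist x y = setDist G X Y := by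
  obtain ⟨x, hx⟩ := hX
  obtain ⟨y, hy⟩ := hY
  exact Nat.sInf_mem (s := {m : ℕ | ∃ x ∈ X, ∃ y ∈ Y, G.dist x y = m}) ⟨_, x, hx, y, hy, rfl⟩

theorem setDist_singleton (G : SimpleGraph Λ) (i j : Λ) : setDist G {i} {j} = G.dist i j := by
  obtain ⟨x, hx, y, hy, h⟩ := exists_setDist_eq G (Finset.singleton_nonempty i)
    (Finset.singleton_nonempty j)
  rw [Finset.mem_singleton] at hx hy
  rw [← h, hx, hy]

theorem disjoint_of_setDist_pos {G : SimpleGraph Λ} {X Y : Finset Λ} (h : 0 < setDist G X Y) :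
    Disjoint X Y := by
  rw [Finset.disjoint_left]
  intro x hx hy
  have := setDist_le (G := G) hx hy
  rw [SimpleGraph.dist_self] at this
  omega

end

variable {Λ : Type} [Fintype Λ] [DecidableEq Λ]

open MeasureTheory in
-- Layer-cake formula: e^{-νd} is the integral of νe^{-νx} over x > d. After the exchange of sum and
-- integral, the number of sites closer than x is at most γx^D, and a Gamma integral remains.
theorem sum_exp_neg_dist_le {G : SimpleGraph Λ} (hconn : G.Connected) {D : ℕ} {γ : ℝ}
    (hγ : 0 ≤ γ) (hG : HasGrowth G D γ) {ν : ℝ} (hν : 0 < ν) (i : Λ) :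
    ∑ j ∈ Finset.univ.erase i, Real.exp (-ν * (G.dist i j : ℝ)) ≤
      γ * (D.factorial : ℝ) * ν⁻¹ ^ D := by
  classical
  have hpos : ∀ j ∈ Finset.univ.erase i, (1 : ℝ) ≤ G.dist i j := by
    intro j hj
    have : 0 < G.dist i j := hconn.pos_dist_of_ne (Finset.ne_of_mem_erase hj).symm
    exact_mod_cast this
  have hexp : ∀ d : ℝ, IntegrableOn (fun x => ν * Real.exp (-ν * x)) (Set.Ioi d) := fun d =>
    (integrableOn_exp_mul_Ioi (by linarith) d).const_mul ν
  have hterm : ∀ j ∈ Finset.univ.erase i, Real.exp (-ν * (G.dist i j : ℝ)) =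
      ∫ x in Set.Ioi (0 : ℝ),
        (Set.Ioi (G.dist i j : ℝ)).indicator (fun x => ν * Real.exp (-ν * x)) x := by
    intro j _
    rw [setIntegral_indicator measurableSet_Ioi,
      Set.inter_eq_self_of_subset_right (Set.Ioi_subset_Ioi (Nat.cast_nonneg _)),
      integral_const_mul, integral_exp_mul_Ioi (by linarith)]
    field_simp
  have hgamma : ∫ x in Set.Ioi (0 : ℝ), γ * ν * (x ^ ((D : ℝ) + 1 - 1) * Real.exp (-(ν * x))) =
      γ * (D.factorial : ℝ) * ν⁻¹ ^ D := by
    rw [integral_const_mul, Real.integral_rpow_mul_exp_neg_mul_Ioi (by positivity) hν,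
      Real.Gamma_nat_eq_factorial, Real.rpow_add (by positivity), Real.rpow_natCast, Real.rpow_one]
    field_simp
  have hgi : IntegrableOn (fun x : ℝ => γ * ν * (x ^ ((D : ℝ) + 1 - 1) * Real.exp (-(ν * x))))
      (Set.Ioi 0) := by
    refine Integrable.const_mul ?_ _
    have h := integrableOn_rpow_mul_exp_neg_mul_rpow (s := (D : ℝ) + 1 - 1) (p := 1) (b := ν)
      (by have : (0 : ℝ) ≤ D := Nat.cast_nonneg _
          linarith) one_pos hν
    refine h.congr_fun (fun x _ => ?_) measurableSet_Ioi
    simp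
  rw [Finset.sum_congr rfl hterm, ← integral_finsetSum _ fun j _ =>
    ((hexp _).integrable_indicator measurableSet_Ioi).integrableOn, ← hgamma]
  refine setIntegral_mono_on (integrable_finsetSum _ fun j _ =>
    ((hexp _).integrable_indicator measurableSet_Ioi).integrableOn) hgi measurableSet_Ioi ?_
  intro x hx
  have hx0 : 0 < x := hx
  rw [show ∑ j ∈ Finset.univ.erase i, (Set.Ioi (G.dist i j : ℝ)).indicator
      (fun x => ν * Real.exp (-ν * x)) x =
      (((Finset.univ.erase i).filter fun j => (G.dist i j : ℝ) < x).card : ℝ) *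
        (ν * Real.exp (-ν * x)) by
    simp only [Set.indicator_apply, Set.mem_Ioi]
    rw [← Finset.sum_filter, Finset.sum_const, nsmul_eq_mul]]
  rw [show (D : ℝ) + 1 - 1 = D by ring, Real.rpow_natCast]
  have hcard : (((Finset.univ.erase i).filter fun j => (G.dist i j : ℝ) < x).card : ℝ) ≤
      γ * x ^ D := by
    -- Growth is only assumed for radii at least 1; below that nothing is counted, since i itself is
    -- erased.
    rcases lt_or_ge x 1 with h1 | h1
    · rw [Finset.filter_eq_empty_iff.2]
      · simp only [Finset.card_empty, Nat.cast_zero]; positivity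
      · intro j hj h
        exact absurd (hpos j hj) (by linarith)
    · refine le_trans ?_ (hG i x h1).2
      exact_mod_cast Finset.card_le_card fun j hj => by
        simp only [Finset.mem_filter, ball] at hj ⊢
        exact ⟨Finset.mem_univ _, hj.2.le⟩
  calc _ ≤ γ * x ^ D * (ν * Real.exp (-ν * x)) := by gcongr
    _ = _ := by rw [neg_mul]; ring

theorem sum_univ_exp_neg_dist_le {G : SimpleGraph Λ} (hconn : G.Connected) {D : ℕ} {γ : ℝ}
    (hγ : 0 ≤ γ) (hG : HasGrowth G D γ) {ν : ℝ} (hν : 0 < ν) (i : Λ) :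
    ∑ j, Real.exp (-ν * (G.dist i j : ℝ)) ≤ 1 + γ * (D.factorial : ℝ) * ν⁻¹ ^ D := by
  rw [← Finset.add_sum_erase _ _ (Finset.mem_univ i)]
  gcongr
  · simp
  · exact sum_exp_neg_dist_le hconn hγ hG hν i

/-- A site of `X` at distance `m` from a site outside of `X` is at distance at most `m` from the
surface of `X`. -/
theorem exists_mem_surface_dist_le {G : SimpleGraph Λ} (hconn : G.Connected) {X : Finset Λ}
    {i l : Λ} (hi : i ∈ X) (hl : l ∉ X) : ∃ b ∈ surface G X, G.dist i b ≤ G.dist i l := by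
  obtain ⟨p, hp⟩ := hconn.exists_walk_length_eq_dist i l
  rw [← hp]
  clear hp
  -- The required surface site is the last one before the walk first leaves X.
  induction p with
  | nil => exact absurd hi hl
  | @cons u v w huv q ih =>
    by_cases hv : v ∈ X
    · obtain ⟨b, hb, hd⟩ := ih hv hl
      refine ⟨b, hb, ?_⟩
      have h1 := hconn.dist_triangle (u := u) (v := v) (w := b)
      rw [SimpleGraph.dist_eq_one_iff_adj.2 huv] at h1
      rw [SimpleGraph.Walk.length_cons]
      omega
    · refine ⟨u, ?_, by simp⟩
      rw [surface, Finset.mem_filter]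
      refine ⟨hi, le_antisymm ?_ ?_⟩
      · rw [← SimpleGraph.dist_eq_one_iff_adj.2 huv]
        exact setDist_le (Finset.mem_singleton_self u) (Finset.mem_compl.2 hv)
      · obtain ⟨x, hx, y, hy, h⟩ := exists_setDist_eq G (Finset.singleton_nonempty u)
          ⟨v, Finset.mem_compl.2 hv⟩
        rw [← h, Finset.mem_singleton.1 hx]
        refine hconn.pos_dist_of_ne ?_
        rintro rfl
        exact Finset.mem_compl.1 hy hi

theorem card_surface_singleton_le (G : SimpleGraph Λ) (i : Λ) :
    (surface G {i}).card ≤ 1 := by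
  refine (Finset.card_filter_le _ _).trans ?_
  simp

end Lattice
end

/-! ### Heisenberg dynamics and commutator growth -/

noncomputable section

namespace Dynamics

variable {𝔸 : Type*} [CStarAlgebra 𝔸]

/-- The propagator `e^{iHt}`. -/
def propagator (H : 𝔸) (t : ℝ) : 𝔸 := NormedSpace.exp ((Complex.I * t) • H)

/-- The Heisenberg evolution `e^{iHt} O e^{-iHt}`. -/
def heisenberg (H : 𝔸) (t : ℝ) (O : 𝔸) : 𝔸 := propagator H t * O * propagator H (-t)

theorem propagator_zero (H : 𝔸) : propagator H 0 = 1 := by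
  simp [propagator]

theorem propagator_mul_neg (H : 𝔸) (t : ℝ) : propagator H t * propagator H (-t) = 1 := by
  let _ : NormedAlgebra ℚ 𝔸 := .restrictScalars ℚ ℂ 𝔸
  have hc : Commute ((Complex.I * t) • H) ((Complex.I * ((-t : ℝ) : ℂ)) • H) :=
    ((Commute.refl H).smul_left _).smul_right _
  rw [propagator, propagator, ← NormedSpace.exp_add_of_commute hc, ← add_smul]
  simp

theorem propagator_neg_mul (H : 𝔸) (t : ℝ) : propagator H (-t) * propagator H t = 1 := by
  simpa using propagator_mul_neg H (-t)

theorem propagator_mem_unitary {H : 𝔸} (hH : IsSelfAdjoint H) (t : ℝ) :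
    propagator H t ∈ unitary 𝔸 := by
  let _ : NormedAlgebra ℚ 𝔸 := .restrictScalars ℚ ℂ 𝔸
  refine NormedSpace.exp_mem_unitary_of_mem_skewAdjoint ?_
  rw [skewAdjoint.mem_iff, star_smul, hH.star_eq]
  simp

theorem propagator_add {H K : 𝔸} (h : Commute H K) (t : ℝ) :
    propagator (H + K) t = propagator H t * propagator K t := by
  let _ : NormedAlgebra ℚ 𝔸 := .restrictScalars ℚ ℂ 𝔸
  rw [propagator, propagator, propagator, ← NormedSpace.exp_add_of_commute, smul_add]
  exact (h.smul_left _).smul_right _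

theorem commute_propagator {H A : 𝔸} (h : Commute A H) (t : ℝ) : Commute A (propagator H t) :=
  Commute.exp_right (h.smul_right _)

theorem propagator_neg_left (H : 𝔸) (t : ℝ) : propagator (-H) t = propagator H (-t) := by
  simp [propagator]

theorem hasDerivAt_propagator (H : 𝔸) (t : ℝ) :
    HasDerivAt (propagator H) (propagator H t * (Complex.I • H)) t := by
  have h := (hasDerivAt_exp_smul_const (𝕂 := ℝ) (Complex.I • H) t)
  have e : ∀ u : ℝ, u • (Complex.I • H) = (Complex.I * u) • H := by
    intro u
    rw [mul_comm, mul_smul]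
    rfl
  simp only [e] at h
  exact h

theorem hasDerivAt_propagator' (H : 𝔸) (t : ℝ) :
    HasDerivAt (propagator H) ((Complex.I • H) * propagator H t) t := by
  refine (hasDerivAt_propagator H t).congr_deriv ?_
  exact (commute_propagator ((Commute.refl H).smul_left Complex.I) t).symm

theorem norm_heisenberg {H : 𝔸} (hH : IsSelfAdjoint H) (t : ℝ) (O : 𝔸) :
    ‖heisenberg H t O‖ = ‖O‖ := by
  rw [heisenberg, CStarRing.norm_mul_mem_unitary _ (propagator_mem_unitary hH _),
    CStarRing.norm_mem_unitary_mul _ (propagator_mem_unitary hH _)]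

theorem norm_commutator_le (A B : 𝔸) : ‖A * B - B * A‖ ≤ 2 * ‖A‖ * ‖B‖ := by
  refine (norm_sub_le _ _).trans ?_
  have h1 := norm_mul_le A B
  have h2 := norm_mul_le B A
  linarith [mul_comm ‖A‖ ‖B‖]

theorem heisenberg_neg_left (H : 𝔸) (t : ℝ) (O : 𝔸) :
    heisenberg (-H) t O = heisenberg H (-t) O := by
  rw [heisenberg, heisenberg, propagator_neg_left, propagator_neg_left]

theorem heisenberg_sum {ι : Type*} (H : 𝔸) (t : ℝ) (s : Finset ι) (O : ι → 𝔸) :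
    heisenberg H t (∑ i ∈ s, O i) = ∑ i ∈ s, heisenberg H t (O i) := by
  simp only [heisenberg, Finset.mul_sum, Finset.sum_mul]

theorem heisenberg_smul (H : 𝔸) (t : ℝ) (c : ℂ) (O : 𝔸) :
    heisenberg H t (c • O) = c • heisenberg H t O := by
  simp only [heisenberg, mul_smul_comm, smul_mul_assoc]

theorem norm_commutator_heisenberg_symm {H : 𝔸} (hH : IsSelfAdjoint H) (t : ℝ) (A B : 𝔸) :
    ‖heisenberg H t A * B - B * heisenberg H t A‖ =
      ‖heisenberg H (-t) B * A - A * heisenberg H (-t) B‖ := by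
  rw [← norm_heisenberg hH (-t) (heisenberg H t A * B - B * heisenberg H t A)]
  rw [← norm_neg]
  congr 1
  have h1 := propagator_mul_neg H t
  have h2 := propagator_neg_mul H t
  simp only [heisenberg, neg_neg]
  calc -(propagator H (-t) * (propagator H t * A * propagator H (-t) * B -
        B * (propagator H t * A * propagator H (-t))) * propagator H t)
      = propagator H (-t) * B * propagator H t * A * (propagator H (-t) * propagator H t) -
        (propagator H (-t) * propagator H t) * A * (propagator H (-t) * B * propagator H t) := by
        noncomm_ring
    _ = _ := by rw [h2]; noncomm_ring

/-- Commutator growth: if the `H₀`-evolution of `A` commutes with `B`, then the commutator of the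
`H`-evolution of `A` with `B` is controlled by those of the evolution of `H - H₀` with `B`. -/
theorem norm_commutator_heisenberg_le {H H₀ A B : 𝔸} (hH : IsSelfAdjoint H)
    (hH₀ : IsSelfAdjoint H₀) {t : ℝ} (ht : 0 ≤ t) (hAB : Commute (heisenberg H₀ t A) B)
    {b b' : ℝ → ℝ} (hb : ∀ s, HasDerivAt b (b' s) s) (hb0 : b 0 = 0)
    (hbound : ∀ s ∈ Set.Ico 0 t,
      ‖heisenberg H s (H - H₀) * B - B * heisenberg H s (H - H₀)‖ ≤ b' s) :
    ‖heisenberg H t A * B - B * heisenberg H t A‖ ≤ 2 * ‖A‖ * b t := by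
  -- Interaction picture: W carries the `H₀`-evolution to the H-evolution, and V is its inverse.
  -- Moving W and V onto B leaves the commutator of the `H₀`-evolved A with VBW - B, as that
  -- operator commutes with B.
  set W : ℝ → 𝔸 := fun s => propagator H s * propagator H₀ (-s) with hW
  set V : ℝ → 𝔸 := fun s => propagator H₀ s * propagator H (-s) with hV
  have hWV : ∀ s, W s * V s = 1 := by
    intro s
    calc W s * V s = propagator H s * (propagator H₀ (-s) * propagator H₀ s) *
          propagator H (-s) := by simp only [hW, hV, mul_assoc]
      _ = 1 := by rw [propagator_neg_mul, mul_one, propagator_mul_neg]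
  have hWu : ∀ s, W s ∈ unitary 𝔸 := fun s =>
    mul_mem (propagator_mem_unitary hH _) (propagator_mem_unitary hH₀ _)
  have hVu : ∀ s, V s ∈ unitary 𝔸 := fun s =>
    mul_mem (propagator_mem_unitary hH₀ _) (propagator_mem_unitary hH _)
  have hneg : ∀ (K : 𝔸) (s : ℝ), HasDerivAt (fun s => propagator K (-s))
      (-((Complex.I • K) * propagator K (-s))) s := by
    intro K s
    exact ((hasDerivAt_propagator' K (-s)).scomp s (hasDerivAt_neg s)).congr_deriv
      (neg_one_smul ℝ _)
  have hderiv : ∀ s, HasDerivAt (fun s => V s * B * W s - B)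
      (V s * ((-Complex.I) • (heisenberg H s (H - H₀) * B - B * heisenberg H s (H - H₀))) *
        W s) s := by
    intro s
    have dW : HasDerivAt W (propagator H s * Complex.I • H * propagator H₀ (-s) +
        propagator H s * -(Complex.I • H₀ * propagator H₀ (-s))) s :=
      (hasDerivAt_propagator H s).mul (hneg H₀ s)
    have dV : HasDerivAt V (propagator H₀ s * Complex.I • H₀ * propagator H (-s) +
        propagator H₀ s * -(Complex.I • H * propagator H (-s))) s :=
      (hasDerivAt_propagator H₀ s).mul (hneg H s)
    refine (((dV.mul_const B).mul dW).sub_const B).congr_deriv ?_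
    have h1 := propagator_neg_mul H s
    have e1 : V s * heisenberg H s (H - H₀) =
        propagator H₀ s * (H - H₀) * propagator H (-s) := by
      calc V s * heisenberg H s (H - H₀) = propagator H₀ s *
            (propagator H (-s) * propagator H s) * (H - H₀) * propagator H (-s) := by
            simp only [hV, heisenberg, mul_assoc]
        _ = _ := by rw [h1, mul_one]
    have e2 : heisenberg H s (H - H₀) * W s =
        propagator H s * (H - H₀) * propagator H₀ (-s) := by
      calc heisenberg H s (H - H₀) * W s = propagator H s * (H - H₀) *
            (propagator H (-s) * propagator H s) * propagator H₀ (-s) := by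
            simp only [hW, heisenberg, mul_assoc]
        _ = _ := by rw [h1, mul_one]
    have e3 : V s * ((-Complex.I) • (heisenberg H s (H - H₀) * B - B * heisenberg H s (H - H₀))) *
        W s = (-Complex.I) • ((V s * heisenberg H s (H - H₀)) * B * W s -
          V s * B * (heisenberg H s (H - H₀) * W s)) := by
      rw [mul_smul_comm, smul_mul_assoc]
      congr 1
      noncomm_ring
    rw [e3, e1, e2]
    simp only [hV, hW, smul_mul_assoc, mul_smul_comm, neg_smul, mul_sub, sub_mul, smul_sub,
      mul_neg, neg_mul, add_mul, mul_add, mul_assoc]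
    abel
  -- Since V and W are unitary, the derivative of VBW - B has the norm of the commutator of the
  -- evolved H - `H₀` with B, so b dominates by comparison of derivatives.
  have hBt : ‖V t * B * W t - B‖ ≤ b t := by
    refine image_norm_le_of_norm_deriv_right_le_deriv_boundary
      (fun s _ => (hderiv s).continuousAt.continuousWithinAt)
      (fun s _ => (hderiv s).hasDerivWithinAt) ?_ hb ?_ (Set.right_mem_Icc.2 ht)
    · simp [hV, hW, propagator_zero, hb0]
    · intro s hs
      rw [CStarRing.norm_mul_mem_unitary _ (hWu s), CStarRing.norm_mem_unitary_mul _ (hVu s),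
        norm_smul]
      simpa using hbound s hs
  have e4 : heisenberg H t A = W t * heisenberg H₀ t A * V t := by
    have h1 := propagator_neg_mul H₀ t
    calc heisenberg H t A = propagator H t * (propagator H₀ (-t) * propagator H₀ t) * A *
          (propagator H₀ (-t) * propagator H₀ t) * propagator H (-t) := by
          rw [h1, mul_one, mul_one, heisenberg]
      _ = _ := by simp only [hV, hW, heisenberg, mul_assoc]
  have e5 : heisenberg H t A * B - B * heisenberg H t A =
      W t * (heisenberg H₀ t A * (V t * B * W t - B) - (V t * B * W t - B) * heisenberg H₀ t A) *
        V t := by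
    have h2 : heisenberg H₀ t A * B = B * heisenberg H₀ t A := hAB
    have h3 : heisenberg H₀ t A * (V t * B * W t - B) -
        (V t * B * W t - B) * heisenberg H₀ t A =
        heisenberg H₀ t A * (V t * B * W t) - (V t * B * W t) * heisenberg H₀ t A := by
      rw [mul_sub, sub_mul, h2]
      abel
    rw [h3, e4]
    calc _ = W t * heisenberg H₀ t A * V t * B * (W t * V t) -
          (W t * V t) * B * (W t * heisenberg H₀ t A * V t) := by
          rw [hWV, mul_one, one_mul]
      _ = _ := by noncomm_ring
  rw [e5, CStarRing.norm_mul_mem_unitary _ (hVu t), CStarRing.norm_mem_unitary_mul _ (hWu t)]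
  refine (norm_commutator_le _ _).trans ?_
  rw [norm_heisenberg hH₀]
  gcongr

end Dynamics

/-! ### Supports of operators -/

namespace ManyBodyOp

variable {Λ : Type} [Fintype Λ] [DecidableEq Λ] {d₀ : ℕ}

theorem evolve_eq_heisenberg (H : ManyBodyOp Λ d₀) (t : ℝ) (O : ManyBodyOp Λ d₀) :
    evolve H t O = Dynamics.heisenberg H t O := by
  rw [evolve, Dynamics.heisenberg, Dynamics.propagator, Dynamics.propagator]
  push_cast
  rw [mul_neg]

theorem embed_mul_embed_apply {X Y : Finset Λ} (hXY : Disjoint X Y)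
    (a : Matrix (X → Fin d₀) (X → Fin d₀) ℂ) (b : Matrix (Y → Fin d₀) (Y → Fin d₀) ℂ)
    (σ τ : Λ → Fin d₀) :
    (embed X a * embed Y b) σ τ = if ∀ i, i ∉ X → i ∉ Y → σ i = τ i then
      a (fun i => σ i) (fun i => τ i) * b (fun i => σ i) (fun i => τ i) else 0 := by
  classical
  -- Only one intermediate configuration survives: it must agree with σ off X and with τ off Y,
  -- hence on X.
  rw [Matrix.mul_apply, Finset.sum_eq_single (fun i => if i ∈ X then τ i else σ i)]
  · have h1 : ∀ i, i ∉ X → σ i = if i ∈ X then τ i else σ i := fun i hi => by simp [hi]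
    rw [embed, if_pos h1, embed]
    by_cases h : ∀ i, i ∉ X → i ∉ Y → σ i = τ i
    · rw [if_pos h, if_pos]
      · congr 2
        · ext i; simp
        · ext i
          have : (i : Λ) ∉ X := Finset.disjoint_right.1 hXY i.2
          simp [this]
      · intro i hi
        by_cases hX : i ∈ X
        · simp [hX]
        · simpa [hX] using h i hX hi
    · rw [if_neg h, if_neg, mul_zero]
      intro h'
      refine h fun i hX hY => ?_
      simpa [hX] using h' i hY
  · intro ρ _ hρ
    by_contra hne
    apply hρ
    have hl : embed X a σ ρ ≠ 0 := left_ne_zero_of_mul hne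
    have hr : embed Y b ρ τ ≠ 0 := right_ne_zero_of_mul hne
    have h1 : ∀ i, i ∉ X → σ i = ρ i := by
      by_contra hc; exact hl (if_neg hc)
    have h2 : ∀ i, i ∉ Y → ρ i = τ i := by
      by_contra hc; exact hr (if_neg hc)
    ext i
    by_cases hX : i ∈ X
    · rw [if_pos hX, h2 i (Finset.disjoint_left.1 hXY hX)]
    · rw [if_neg hX, h1 i hX]
  · simp

theorem SupportedOn.commute {X Y : Finset Λ} (hXY : Disjoint X Y) {A B : ManyBodyOp Λ d₀}
    (hA : SupportedOn X A) (hB : SupportedOn Y B) : Commute A B := by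
  obtain ⟨a, rfl⟩ := hA
  obtain ⟨b, rfl⟩ := hB
  ext σ τ
  rw [embed_mul_embed_apply hXY, embed_mul_embed_apply hXY.symm, mul_comm]
  congr 1
  exact propext ⟨fun h i hX hY => h i hY hX, fun h i hX hY => h i hY hX⟩

theorem SupportedOn.conjTranspose {X : Finset Λ} {A : ManyBodyOp Λ d₀} (hA : SupportedOn X A) :
    SupportedOn X A.conjTranspose := by
  obtain ⟨a, rfl⟩ := hA
  refine ⟨a.conjTranspose, ?_⟩
  ext σ τ
  rw [Matrix.conjTranspose_apply, embed, embed]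
  by_cases h : ∀ i, i ∉ X → σ i = τ i
  · rw [if_pos h, if_pos fun i hi => (h i hi).symm, Matrix.conjTranspose_apply]
  · rw [if_neg h, if_neg fun h' => h fun i hi => (h' i hi).symm, star_zero]

theorem SupportedOn.smul {X : Finset Λ} {A : ManyBodyOp Λ d₀} (hA : SupportedOn X A) (c : ℂ) :
    SupportedOn X (c • A) := by
  obtain ⟨a, rfl⟩ := hA
  refine ⟨c • a, ?_⟩
  ext σ τ
  rw [Matrix.smul_apply, embed, embed]
  split_ifs <;> simp

end ManyBodyOp
end

/-! ### Interaction terms crossing the surface of a region -/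

noncomputable section

open Lattice ManyBodyOp

namespace Interaction

variable {Λ : Type} [Fintype Λ] [DecidableEq Λ] {d₀ : ℕ}

/-- The sets of sites that meet `X` without being contained in it. -/
def crossing (X : Finset Λ) : Finset (Finset Λ) :=
  Finset.univ.filter fun Z => ¬ Z ⊆ X ∧ ¬ Disjoint Z X

theorem isSelfAdjoint_sum (Φ : Interaction Λ d₀) (s : Finset (Finset Λ)) :
    IsSelfAdjoint (∑ Z ∈ s, Φ.term Z) :=
  _root_.isSelfAdjoint_sum s fun Z _ => (Φ.isHermitian Z).isSelfAdjoint

theorem isSelfAdjoint_hamiltonian (Φ : Interaction Λ d₀) : IsSelfAdjoint Φ.hamiltonian :=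
  Φ.isHermitian_hamiltonian.isSelfAdjoint

/-- The interaction with the opposite sign. -/
def neg (Φ : Interaction Λ d₀) : Interaction Λ d₀ where
  term Z := -Φ.term Z
  isHermitian Z := (Φ.isHermitian Z).neg
  supportedOn Z := by simpa using (Φ.supportedOn Z).smul (-1)

theorem neg_hamiltonian (Φ : Interaction Λ d₀) : Φ.neg.hamiltonian = -Φ.hamiltonian := by
  simp [hamiltonian, neg]

theorem IsShortRange.neg {Φ : Interaction Λ d₀} {G : SimpleGraph Λ} {k : ℕ} {g g₀ μ₀ : ℝ}
    (h : Φ.IsShortRange G k g g₀ μ₀) : Φ.neg.IsShortRange G k g g₀ μ₀ where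
  local_terms Z hZ := by simp [Interaction.neg, h.local_terms Z hZ]
  one_site i := by simpa [Interaction.neg] using h.one_site i
  decay i j hij := by simpa [Interaction.neg] using h.decay i j hij

/-- Only the terms of the Hamiltonian crossing the surface of `X` contribute to the growth of the
commutator of an operator supported on `X` with an operator supported elsewhere. -/
theorem norm_commutator_le_of_crossing (Φ : Interaction Λ d₀) {X Y : Finset Λ}
    (hXY : Disjoint X Y) {A B : ManyBodyOp Λ d₀} (hA : SupportedOn X A) (hB : SupportedOn Y B)
    {t : ℝ} (ht : 0 ≤ t) {b b' : ℝ → ℝ} (hb : ∀ s, HasDerivAt b (b' s) s) (hb0 : b 0 = 0)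
    (hbound : ∀ s ∈ Set.Ico 0 t, ∑ Z ∈ crossing X,
      ‖Dynamics.heisenberg Φ.hamiltonian s (Φ.term Z) * B -
        B * Dynamics.heisenberg Φ.hamiltonian s (Φ.term Z)‖ ≤ b' s) :
    ‖Dynamics.heisenberg Φ.hamiltonian t A * B - B * Dynamics.heisenberg Φ.hamiltonian t A‖ ≤
      2 * ‖A‖ * b t := by
  set Hin : ManyBodyOp Λ d₀ := ∑ Z with Z ⊆ X, Φ.term Z with hHin
  set Hout : ManyBodyOp Λ d₀ := ∑ Z with ¬ Z ⊆ X ∧ Disjoint Z X, Φ.term Z with hHout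
  have hsplit : Φ.hamiltonian - (Hin + Hout) = ∑ Z ∈ crossing X, Φ.term Z := by
    rw [sub_eq_iff_eq_add', hamiltonian, hHin, hHout, crossing,
      ← Finset.sum_filter_add_sum_filter_not Finset.univ (fun Z => Z ⊆ X), add_assoc]
    congr 1
    rw [← Finset.sum_filter_add_sum_filter_not _ (fun Z => Disjoint Z X), Finset.filter_filter,
      Finset.filter_filter]
  have hcomm : Commute Hin Hout := by
    refine Commute.sum_left _ _ _ fun Z hZ => Commute.sum_right _ _ _ fun Z' hZ' => ?_
    rw [Finset.mem_filter] at hZ hZ'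
    exact SupportedOn.commute (hZ'.2.2.symm.mono_left hZ.2) (Φ.supportedOn Z) (Φ.supportedOn Z')
  have hAout : Commute A Hout := by
    refine Commute.sum_right _ _ _ fun Z hZ => ?_
    rw [Finset.mem_filter] at hZ
    exact SupportedOn.commute hZ.2.2.symm hA (Φ.supportedOn Z)
  have hBin : Commute B Hin := by
    refine Commute.sum_right _ _ _ fun Z hZ => ?_
    rw [Finset.mem_filter] at hZ
    exact SupportedOn.commute (hXY.symm.mono_right hZ.2) hB (Φ.supportedOn Z)
  -- `Hin` and `Hout` commute and `Hout` commutes with A, so only `Hin` moves A. As `Hin` also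
  -- commutes with B, the evolved A still commutes with B.
  have hev : Dynamics.heisenberg (Hin + Hout) t A = Dynamics.heisenberg Hin t A := by
    rw [Dynamics.heisenberg, Dynamics.propagator_add hcomm, add_comm Hin,
      Dynamics.propagator_add hcomm.symm, Dynamics.heisenberg]
    calc _ = Dynamics.propagator Hin t * (Dynamics.propagator Hout t * A) *
          Dynamics.propagator Hout (-t) * Dynamics.propagator Hin (-t) := by
          simp only [mul_assoc]
      _ = Dynamics.propagator Hin t * A * (Dynamics.propagator Hout t *
          Dynamics.propagator Hout (-t)) * Dynamics.propagator Hin (-t) := by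
          rw [← (Dynamics.commute_propagator hAout t).eq]
          simp only [mul_assoc]
      _ = _ := by rw [Dynamics.propagator_mul_neg, mul_one]
  have hH₀ : IsSelfAdjoint (Hin + Hout) := (Φ.isSelfAdjoint_sum _).add (Φ.isSelfAdjoint_sum _)
  refine Dynamics.norm_commutator_heisenberg_le Φ.isSelfAdjoint_hamiltonian hH₀ ht ?_ hb hb0 fun s hs => ?_
  · rw [hev]
    have hAB : Commute A B := SupportedOn.commute hXY hA hB
    exact (((Dynamics.commute_propagator hBin t).mul_right hAB.symm).mul_right
      (Dynamics.commute_propagator hBin (-t))).symm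
  · refine le_trans ?_ (hbound s hs)
    rw [hsplit, Dynamics.heisenberg_sum, Finset.sum_mul, Finset.mul_sum, ← Finset.sum_sub_distrib]
    exact norm_sum_le _ _

end Interaction

namespace Lattice

variable {Λ : Type}

/-- Passing from X to Z through a common site i costs at most the distance from i to the site of Z
nearest to Y. Summing over all j ∈ Z, in place of that site, reduces later estimates to sums over Z
containing prescribed sites. -/
theorem exp_neg_setDist_le {G : SimpleGraph Λ} (hconn : G.Connected) {X Y Z : Finset Λ}
    (hY : Y.Nonempty) {μ : ℝ} (hμ : 0 ≤ μ) {i : Λ} (hX : i ∈ X) (hZ : i ∈ Z) :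
    Real.exp (-μ * (setDist G Z Y : ℝ)) ≤ Real.exp (-μ * (setDist G X Y : ℝ)) *
      ∑ j ∈ Z, Real.exp (μ * (G.dist i j : ℝ)) := by
  obtain ⟨j, hj, y, hy, h⟩ := exists_setDist_eq G ⟨i, hZ⟩ hY
  have h1 : setDist G X Y ≤ G.dist i j + setDist G Z Y := by
    rw [← h]
    exact (setDist_le hX hy).trans hconn.dist_triangle
  have h2 : (setDist G X Y : ℝ) ≤ G.dist i j + setDist G Z Y := by exact_mod_cast h1
  calc Real.exp (-μ * (setDist G Z Y : ℝ))
      ≤ Real.exp (-μ * (setDist G X Y : ℝ)) * Real.exp (μ * (G.dist i j : ℝ)) := by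
        rw [← Real.exp_add, Real.exp_le_exp]
        nlinarith
    _ ≤ _ := by
        gcongr
        exact Finset.single_le_sum (f := fun j => Real.exp (μ * (G.dist i j : ℝ)))
          (fun _ _ => (Real.exp_pos _).le) hj

end Lattice

namespace Interaction

variable {Λ : Type} [Fintype Λ] [DecidableEq Λ] {d₀ : ℕ}

theorem sum_crossing_le (X : Finset Λ) {f : Finset Λ → ℝ} (hf : ∀ Z, 0 ≤ f Z) :
    ∑ Z ∈ crossing X, f Z ≤ ∑ i ∈ X, ∑ l ∈ Xᶜ, ∑ Z with i ∈ Z ∧ l ∈ Z, f Z := by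
  simp only [Finset.sum_filter]
  rw [Finset.sum_congr rfl fun i _ => Finset.sum_comm, Finset.sum_comm, crossing,
    Finset.sum_filter]
  refine Finset.sum_le_sum fun Z _ => ?_
  have hnn : ∀ i l, 0 ≤ if i ∈ Z ∧ l ∈ Z then f Z else 0 := fun i l => by
    split_ifs
    exacts [hf Z, le_rfl]
  split_ifs with h
  · obtain ⟨l, hlZ, hlX⟩ := Finset.not_subset.1 h.1
    obtain ⟨i, hiZ, hiX⟩ := Finset.not_disjoint_iff.1 h.2
    calc f Z = if i ∈ Z ∧ l ∈ Z then f Z else 0 := by rw [if_pos ⟨hiZ, hlZ⟩]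
      _ ≤ ∑ l ∈ Xᶜ, if i ∈ Z ∧ l ∈ Z then f Z else 0 :=
          Finset.single_le_sum (f := fun l => if i ∈ Z ∧ l ∈ Z then f Z else 0)
            (fun l _ => hnn i l) (Finset.mem_compl.2 hlX)
      _ ≤ _ := Finset.single_le_sum
            (f := fun i => ∑ l ∈ Xᶜ, if i ∈ Z ∧ l ∈ Z then f Z else 0)
            (fun i _ => Finset.sum_nonneg fun l _ => hnn i l) hiX
  · exact Finset.sum_nonneg fun i _ => Finset.sum_nonneg fun l _ => hnn i l

theorem sum_crossing_le' (X : Finset Λ) {f : Finset Λ → ℝ} (hf : ∀ Z, 0 ≤ f Z) :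
    ∑ Z ∈ crossing X, f Z ≤ ∑ i ∈ X, ∑ Z with i ∈ Z, f Z := by
  simp only [Finset.sum_filter]
  rw [Finset.sum_comm, crossing, Finset.sum_filter]
  refine Finset.sum_le_sum fun Z _ => ?_
  have hnn : ∀ i, 0 ≤ if i ∈ Z then f Z else 0 := fun i => by
    split_ifs
    exacts [hf Z, le_rfl]
  split_ifs with h
  · obtain ⟨i, hiZ, hiX⟩ := Finset.not_disjoint_iff.1 h.2
    calc f Z = if i ∈ Z then f Z else 0 := by rw [if_pos hiZ]
      _ ≤ _ := Finset.single_le_sum (f := fun i => if i ∈ Z then f Z else 0)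
            (fun i _ => hnn i) hiX
  · exact Finset.sum_nonneg fun i _ => hnn i

section ShortRange

variable {Φ : Interaction Λ d₀} {G : SimpleGraph Λ} {k : ℕ} {g g₀ μ₀ : ℝ}

theorem IsShortRange.sum_pair_le (h : Φ.IsShortRange G k g g₀ μ₀) {i j : Λ} (hij : i ≠ j) :
    ∑ Z with i ∈ Z ∧ j ∈ Z, ‖Φ.term Z‖ ≤ |g₀| * Real.exp (-μ₀ * (G.dist i j : ℝ)) :=
  (h.decay i j hij).trans (by gcongr; exact le_abs_self _)

/-- The sums over Z and j are exchanged: j = i is the one-site energy, and for j ≠ i the decay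
e^{-4νd} absorbs the growth e^{νd}. Absolute values appear because g and g₀ carry no sign. -/
theorem IsShortRange.sum_site_le (h : Φ.IsShortRange G k g g₀ μ₀) {S : ℝ} {ν : ℝ}
    (hν : 4 * ν = μ₀) (hν0 : 0 < ν)
    (hS : ∀ i, ∑ j, Real.exp (-ν * (G.dist i j : ℝ)) ≤ S) (i : Λ) :
    ∑ Z with i ∈ Z, ‖Φ.term Z‖ * ∑ j ∈ Z, Real.exp (ν * (G.dist i j : ℝ)) ≤
      |g| + |g₀| * S := by
  have h1 : ∑ Z with i ∈ Z, ‖Φ.term Z‖ * ∑ j ∈ Z, Real.exp (ν * (G.dist i j : ℝ)) =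
      ∑ j, Real.exp (ν * (G.dist i j : ℝ)) * ∑ Z with i ∈ Z ∧ j ∈ Z, ‖Φ.term Z‖ := by
    simp only [Finset.mul_sum]
    simp only [← Finset.filter_filter, Finset.sum_filter (p := fun Z => _ ∈ Z)
      (s := Finset.univ.filter _)]
    rw [Finset.sum_comm]
    refine Finset.sum_congr rfl fun Z _ => ?_
    rw [← Finset.sum_filter, Finset.filter_mem_eq_inter, Finset.univ_inter]
    exact Finset.sum_congr rfl fun j _ => mul_comm _ _
  rw [h1, ← Finset.add_sum_erase _ _ (Finset.mem_univ i)]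
  gcongr
  · simpa using (h.one_site i).trans (le_abs_self g)
  · calc _ ≤ ∑ j ∈ Finset.univ.erase i, |g₀| * Real.exp (-ν * (G.dist i j : ℝ)) := by
          refine Finset.sum_le_sum fun j hj => ?_
          refine (mul_le_mul_of_nonneg_left
            (h.sum_pair_le (Finset.ne_of_mem_erase hj).symm) (Real.exp_pos _).le).trans ?_
          rw [mul_left_comm, ← Real.exp_add]
          gcongr
          have : (0 : ℝ) ≤ G.dist i j := Nat.cast_nonneg _
          rw [← hν]
          nlinarith
      _ ≤ |g₀| * ∑ j, Real.exp (-ν * (G.dist i j : ℝ)) := by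
          rw [← Finset.mul_sum]
          gcongr
          exact Finset.subset_univ _
      _ ≤ _ := by
          gcongr
          exact hS i

theorem IsShortRange.sum_crossing_exp_le (h : Φ.IsShortRange G k g g₀ μ₀) (hconn : G.Connected)
    {S ν : ℝ} (hν : 4 * ν = μ₀) (hν0 : 0 < ν)
    (hS : ∀ i, ∑ j, Real.exp (-ν * (G.dist i j : ℝ)) ≤ S) {X Y : Finset Λ} (hY : Y.Nonempty) :
    ∑ Z ∈ crossing X, ‖Φ.term Z‖ * Real.exp (-ν * (setDist G Z Y : ℝ)) ≤
      X.card * (|g| + |g₀| * S) * Real.exp (-ν * (setDist G X Y : ℝ)) := by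
  refine (sum_crossing_le' X fun Z => by positivity).trans ?_
  calc _ ≤ ∑ i ∈ X, Real.exp (-ν * (setDist G X Y : ℝ)) * (|g| + |g₀| * S) := by
        refine Finset.sum_le_sum fun i hi => ?_
        refine le_trans ?_ (mul_le_mul_of_nonneg_left (h.sum_site_le hν hν0 hS i)
          (Real.exp_pos _).le)
        rw [Finset.mul_sum]
        refine Finset.sum_le_sum fun Z hZ => ?_
        rw [mul_left_comm]
        gcongr
        exact exp_neg_setDist_le hconn hY hν0.le hi (Finset.mem_filter.1 hZ).2
    _ = _ := by
        rw [Finset.sum_const, nsmul_eq_mul]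
        ring

theorem IsShortRange.sum_crossing_norm_le (h : Φ.IsShortRange G k g g₀ μ₀) {S : ℝ} (hS : 0 ≤ S)
    (X : Finset Λ) :
    ∑ Z ∈ crossing X, ‖Φ.term Z‖ ≤ X.card * (|g| + |g₀| * S) := by
  refine (sum_crossing_le' X fun Z => norm_nonneg _).trans ?_
  rw [← nsmul_eq_mul, ← Finset.sum_const]
  refine Finset.sum_le_sum fun i _ => (h.one_site i).trans ((le_abs_self g).trans ?_)
  have : 0 ≤ |g₀| * S := by positivity
  linarith

/-- The sum is bounded by both pair sums, hence by the geometric mean of their bounds; this halves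
the decay rate but gives decay in both distances at once. -/
theorem IsShortRange.sum_triple_le (h : Φ.IsShortRange G k g g₀ μ₀) (hμ₀ : 0 < μ₀) {i l : Λ}
    (hil : i ≠ l) (j : Λ) :
    ∑ Z with (i ∈ Z ∧ l ∈ Z) ∧ j ∈ Z, ‖Φ.term Z‖ ≤
      |g₀| * Real.exp (-(μ₀ / 2) * (G.dist i l + G.dist i j : ℝ)) := by
  have h1 : ∑ Z with (i ∈ Z ∧ l ∈ Z) ∧ j ∈ Z, ‖Φ.term Z‖ ≤
      |g₀| * Real.exp (-μ₀ * (G.dist i l : ℝ)) := by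
    refine le_trans ?_ (h.sum_pair_le hil)
    refine Finset.sum_le_sum_of_subset_of_nonneg ?_ fun _ _ _ => norm_nonneg _
    intro Z
    simp only [Finset.mem_filter]
    tauto
  have h2 : ∑ Z with (i ∈ Z ∧ l ∈ Z) ∧ j ∈ Z, ‖Φ.term Z‖ ≤
      |g₀| * Real.exp (-(μ₀ / 2) * (G.dist i l + G.dist i j : ℝ)) ∨
      (G.dist i j : ℝ) ≤ G.dist i l := by
    rcases le_total (G.dist i j : ℝ) (G.dist i l) with hle | hle
    · exact Or.inr hle
    · left
      -- The decay hypothesis does not cover i = j; in this branch d(i,l) is then 0 as well.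
      rcases eq_or_ne i j with rfl | hij
      · have hp : (G.dist i l : ℝ) = 0 :=
          le_antisymm (by simpa using hle) (Nat.cast_nonneg _)
        simpa [hp] using h1
      · refine le_trans (Finset.sum_le_sum_of_subset_of_nonneg ?_ fun _ _ _ => norm_nonneg _)
          ((h.sum_pair_le hij).trans ?_)
        · intro Z
          simp only [Finset.mem_filter]
          tauto
        · refine mul_le_mul_of_nonneg_left (Real.exp_le_exp.2 ?_) (abs_nonneg _)
          nlinarith
  rcases h2 with h2 | h2
  · exact h2
  · refine h1.trans (mul_le_mul_of_nonneg_left (Real.exp_le_exp.2 ?_) (abs_nonneg _))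
    nlinarith

/-- A crossing term contains some i ∈ X and l ∉ X, and i lies within d(i,l) of the surface. The rate
4ν is spent as follows: 2ν remain in each of d(i,l) and d(i,j) by `sum_triple_le`; the factor
e^{νd(i,j)} takes ν from the latter, leaving a sum over j. The former is split between the sum over
l and the decay from i to a surface site b. The sums over j, l and i give S³, the sum over b the
size of the surface. -/
theorem IsShortRange.sum_crossing_surface_le (h : Φ.IsShortRange G k g g₀ μ₀)
    (hconn : G.Connected) {S ν : ℝ} (hν : 4 * ν = μ₀) (hν0 : 0 < ν)
    (hS : ∀ i, ∑ j, Real.exp (-ν * (G.dist i j : ℝ)) ≤ S) {X Y : Finset Λ} (hY : Y.Nonempty) :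
    ∑ Z ∈ crossing X, ‖Φ.term Z‖ * Real.exp (-ν * (setDist G Z Y : ℝ)) ≤
      (surface G X).card * (|g₀| * S ^ 3) * Real.exp (-ν * (setDist G X Y : ℝ)) := by
  have hS0 : 0 ≤ S := by
    obtain ⟨i⟩ := hconn.nonempty
    exact (Finset.sum_nonneg fun j _ => (Real.exp_pos _).le).trans (hS i)
  set E := Real.exp (-ν * (setDist G X Y : ℝ)) with hE
  have hpair : ∀ i ∈ X, ∀ l ∈ Xᶜ, ∑ Z with i ∈ Z ∧ l ∈ Z,
      ‖Φ.term Z‖ * Real.exp (-ν * (setDist G Z Y : ℝ)) ≤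
      E * (|g₀| * S) * (Real.exp (-ν * (G.dist i l : ℝ)) *
        ∑ b ∈ surface G X, Real.exp (-ν * (G.dist b i : ℝ))) := by
    intro i hi l hl
    have hl' : l ∉ X := Finset.mem_compl.1 hl
    have hil : i ≠ l := by rintro rfl; exact hl' hi
    obtain ⟨b, hb, hbl⟩ := exists_mem_surface_dist_le hconn hi hl'
    have hbl' : (G.dist b i : ℝ) ≤ G.dist i l := by
      rw [SimpleGraph.dist_comm]; exact_mod_cast hbl
    calc ∑ Z with i ∈ Z ∧ l ∈ Z, ‖Φ.term Z‖ * Real.exp (-ν * (setDist G Z Y : ℝ))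
        ≤ ∑ Z with i ∈ Z ∧ l ∈ Z, ‖Φ.term Z‖ *
            (E * ∑ j ∈ Z, Real.exp (ν * (G.dist i j : ℝ))) := by
          refine Finset.sum_le_sum fun Z hZ => ?_
          gcongr
          exact exp_neg_setDist_le hconn hY hν0.le hi (Finset.mem_filter.1 hZ).2.1
      _ = E * ∑ j, Real.exp (ν * (G.dist i j : ℝ)) *
            ∑ Z with (i ∈ Z ∧ l ∈ Z) ∧ j ∈ Z, ‖Φ.term Z‖ := by
          simp only [Finset.mul_sum]
          simp only [← Finset.filter_filter (p := fun Z => i ∈ Z ∧ l ∈ Z),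
            Finset.sum_filter (p := fun Z => _ ∈ Z) (s := Finset.univ.filter (fun Z => _ ∧ _))]
          rw [Finset.sum_comm]
          refine Finset.sum_congr rfl fun Z _ => ?_
          rw [← Finset.sum_filter, Finset.filter_mem_eq_inter, Finset.univ_inter]
          exact Finset.sum_congr rfl fun j _ => by ring
      _ ≤ E * ∑ j, |g₀| * Real.exp (-(2 * ν) * (G.dist i l : ℝ)) *
            Real.exp (-ν * (G.dist i j : ℝ)) := by
          refine mul_le_mul_of_nonneg_left (Finset.sum_le_sum fun j _ => ?_) (Real.exp_pos _).le
          refine (mul_le_mul_of_nonneg_left (h.sum_triple_le (by linarith) hil j)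
            (Real.exp_pos _).le).trans (le_of_eq ?_)
          rw [mul_left_comm, mul_assoc, ← Real.exp_add, ← Real.exp_add, ← hν]
          ring_nf
      _ ≤ E * (|g₀| * Real.exp (-(2 * ν) * (G.dist i l : ℝ)) * S) := by
          rw [← Finset.mul_sum]
          gcongr
          exact hS i
      _ = E * (|g₀| * S) * (Real.exp (-ν * (G.dist i l : ℝ)) *
            Real.exp (-ν * (G.dist i l : ℝ))) := by
          rw [← Real.exp_add]
          ring_nf
      _ ≤ _ := by
          gcongr
          refine le_trans ?_ (Finset.single_le_sum
            (f := fun b => Real.exp (-ν * (G.dist b i : ℝ))) (fun _ _ => (Real.exp_pos _).le) hb)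
          rw [Real.exp_le_exp]
          nlinarith
  refine (sum_crossing_le X fun Z => by positivity).trans ?_
  calc _ ≤ ∑ i ∈ X, ∑ l ∈ Xᶜ, E * (|g₀| * S) * (Real.exp (-ν * (G.dist i l : ℝ)) *
        ∑ b ∈ surface G X, Real.exp (-ν * (G.dist b i : ℝ))) :=
        Finset.sum_le_sum fun i hi => Finset.sum_le_sum fun l hl => hpair i hi l hl
    _ = E * (|g₀| * S) * ∑ i ∈ X, (∑ l ∈ Xᶜ, Real.exp (-ν * (G.dist i l : ℝ))) *
        ∑ b ∈ surface G X, Real.exp (-ν * (G.dist b i : ℝ)) := by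
        rw [Finset.mul_sum]
        refine Finset.sum_congr rfl fun i _ => ?_
        rw [Finset.sum_mul, Finset.mul_sum]
    _ ≤ E * (|g₀| * S) * ∑ i ∈ X, S * ∑ b ∈ surface G X, Real.exp (-ν * (G.dist b i : ℝ)) := by
        gcongr with i _
        exact (Finset.sum_le_sum_of_subset_of_nonneg (Finset.subset_univ _)
          fun _ _ _ => (Real.exp_pos _).le).trans (hS i)
    _ = E * (|g₀| * S) * (S * ∑ b ∈ surface G X, ∑ i ∈ X,
        Real.exp (-ν * (G.dist b i : ℝ))) := by
        rw [← Finset.mul_sum, Finset.sum_comm]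
    _ ≤ E * (|g₀| * S) * (S * ∑ b ∈ surface G X, S) := by
        gcongr with b _
        exact (Finset.sum_le_sum_of_subset_of_nonneg (Finset.subset_univ _)
            fun _ _ _ => (Real.exp_pos _).le).trans (hS b)
    _ = _ := by
        rw [Finset.sum_const, nsmul_eq_mul]
        ring

end ShortRange

end Interaction
end

/-! ### The Lieb-Robinson bound -/

noncomputable section

open Lattice ManyBodyOp

namespace Interaction

section LiebRobinsonBound

variable {Λ : Type} [Fintype Λ] [DecidableEq Λ] {d₀ : ℕ}
  {Φ : Interaction Λ d₀} {G : SimpleGraph Λ} {k : ℕ} {g g₀ μ₀ : ℝ}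

/-- A Grönwall argument done by Picard iteration. The trivial commutator bound starts it; each use
of the crossing estimate turns (κs)^N/N! into the next term, while the part decaying in the distance
reproduces itself because a support of at most k sites contributes a total rate at most κ. -/
theorem IsShortRange.norm_commutator_iterate_le (h : Φ.IsShortRange G k g g₀ μ₀)
    (hconn : G.Connected) {S ν κ : ℝ} (hν : 4 * ν = μ₀) (hν0 : 0 < ν)
    (hS : ∀ i, ∑ j, Real.exp (-ν * (G.dist i j : ℝ)) ≤ S)
    (hκ : 2 * (k * (|g| + |g₀| * S)) ≤ κ) {Y : Finset Λ} (hY : Y.Nonempty)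
    {B : ManyBodyOp Λ d₀} (hB : SupportedOn Y B) (N : ℕ) :
    ∀ Z : Finset Λ, Z.Nonempty → Z.card ≤ k → ∀ A : ManyBodyOp Λ d₀, SupportedOn Z A →
      ∀ t : ℝ, 0 ≤ t →
      ‖Dynamics.heisenberg Φ.hamiltonian t A * B - B * Dynamics.heisenberg Φ.hamiltonian t A‖ ≤
        2 * ‖A‖ * (‖B‖ * (Real.exp (-ν * (setDist G Z Y : ℝ)) * Real.exp (κ * t) +
          (κ * t) ^ N / N.factorial)) := by
  have hS0 : 0 ≤ S := by
    obtain ⟨i⟩ := hconn.nonempty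
    exact (Finset.sum_nonneg fun j _ => (Real.exp_pos _).le).trans (hS i)
  have hJ : 0 ≤ |g| + |g₀| * S := by positivity
  have hκ0 : 0 ≤ κ := le_trans (by positivity) hκ
  have htriv : ∀ (A : ManyBodyOp Λ d₀) (t : ℝ),
      ‖Dynamics.heisenberg Φ.hamiltonian t A * B -
        B * Dynamics.heisenberg Φ.hamiltonian t A‖ ≤ 2 * ‖A‖ * ‖B‖ := by
    intro A t
    refine (Dynamics.norm_commutator_le _ _).trans ?_
    rw [Dynamics.norm_heisenberg Φ.isSelfAdjoint_hamiltonian]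
  induction N with
  | zero =>
    intro Z _ _ A _ t ht
    refine (htriv A t).trans (mul_le_mul_of_nonneg_left ?_ (by positivity))
    refine le_mul_of_one_le_right (norm_nonneg _) ?_
    simp only [pow_zero, Nat.factorial_zero, Nat.cast_one, div_one]
    have : 0 ≤ Real.exp (-ν * (setDist G Z Y : ℝ)) * Real.exp (κ * t) := by positivity
    linarith
  | succ N ih =>
    intro Z hZ hZk A hA t ht
    -- At distance 0 the supports may overlap, but then the spatial factor is 1 and the trivial
    -- bound suffices.
    rcases Nat.eq_zero_or_pos (setDist G Z Y) with hd | hd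
    · refine (htriv A t).trans (mul_le_mul_of_nonneg_left ?_ (by positivity))
      refine le_mul_of_one_le_right (norm_nonneg _) ?_
      rw [hd]
      have h1 : 1 ≤ Real.exp (κ * t) := Real.one_le_exp (by positivity)
      have h2 : 0 ≤ (κ * t) ^ (N + 1) / ((N + 1).factorial : ℝ) := by positivity
      simp only [Nat.cast_zero, mul_zero, Real.exp_zero, one_mul]
      linarith
    · set E := Real.exp (-ν * (setDist G Z Y : ℝ)) with hE
      have hb : ∀ s, HasDerivAt (fun s => ‖B‖ * (E * (Real.exp (κ * s) - 1) +
          (κ * s) ^ (N + 1) / ((N + 1).factorial : ℝ)))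
          (‖B‖ * (κ * (E * Real.exp (κ * s) + (κ * s) ^ N / (N.factorial : ℝ)))) s := by
        intro s
        have h1 : HasDerivAt (fun s : ℝ => κ * s) κ s := by
          simpa using (hasDerivAt_id s).const_mul κ
        refine ((((h1.exp.sub_const 1).const_mul E).add
          ((h1.pow (N + 1)).div_const ((N + 1).factorial : ℝ))).const_mul ‖B‖).congr_deriv ?_
        rw [Nat.factorial_succ]
        push_cast
        have : (N.factorial : ℝ) ≠ 0 := by positivity
        have : (N : ℝ) + 1 ≠ 0 := by positivity
        field_simp
      refine (norm_commutator_le_of_crossing Φ (disjoint_of_setDist_pos hd) hA hB ht hb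
        (by simp) fun s hs => ?_).trans ?_
      · have hs0 : 0 ≤ s := hs.1
        calc ∑ Z' ∈ crossing Z, ‖Dynamics.heisenberg Φ.hamiltonian s (Φ.term Z') * B -
              B * Dynamics.heisenberg Φ.hamiltonian s (Φ.term Z')‖
            ≤ ∑ Z' ∈ crossing Z, 2 * ‖Φ.term Z'‖ * (‖B‖ *
                (Real.exp (-ν * (setDist G Z' Y : ℝ)) * Real.exp (κ * s) +
                  (κ * s) ^ N / (N.factorial : ℝ))) := by
              refine Finset.sum_le_sum fun Z' hZ' => ?_
              by_cases hk : Z'.card ≤ k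
              · obtain ⟨i, hi, -⟩ := Finset.not_disjoint_iff.1 (Finset.mem_filter.1 hZ').2.2
                exact ih Z' ⟨i, hi⟩ hk _ (Φ.supportedOn Z') s hs0
              · simp [h.local_terms Z' (not_le.1 hk), Dynamics.heisenberg]
          _ = 2 * ‖B‖ * (Real.exp (κ * s) * ∑ Z' ∈ crossing Z, ‖Φ.term Z'‖ *
                Real.exp (-ν * (setDist G Z' Y : ℝ)) +
                (κ * s) ^ N / (N.factorial : ℝ) * ∑ Z' ∈ crossing Z, ‖Φ.term Z'‖) := by
              rw [Finset.mul_sum, Finset.mul_sum, ← Finset.sum_add_distrib, Finset.mul_sum]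
              refine Finset.sum_congr rfl fun _ _ => by ring
          _ ≤ 2 * ‖B‖ * (Real.exp (κ * s) * (k * (|g| + |g₀| * S) * E) +
                (κ * s) ^ N / (N.factorial : ℝ) * (k * (|g| + |g₀| * S))) := by
              have hZk' : (Z.card : ℝ) ≤ k := by exact_mod_cast hZk
              gcongr
              · refine (h.sum_crossing_exp_le hconn hν hν0 hS hY).trans ?_
                gcongr
              · refine (h.sum_crossing_norm_le hS0 Z).trans ?_
                gcongr
          _ = ‖B‖ * (2 * (k * (|g| + |g₀| * S)) *
                (E * Real.exp (κ * s) + (κ * s) ^ N / (N.factorial : ℝ))) := by ring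
          _ ≤ _ := by gcongr
      · gcongr
        linarith

theorem IsShortRange.norm_commutator_local_le (h : Φ.IsShortRange G k g g₀ μ₀)
    (hconn : G.Connected) {S ν κ : ℝ} (hν : 4 * ν = μ₀) (hν0 : 0 < ν)
    (hS : ∀ i, ∑ j, Real.exp (-ν * (G.dist i j : ℝ)) ≤ S)
    (hκ : 2 * (k * (|g| + |g₀| * S)) ≤ κ) {Y : Finset Λ} (hY : Y.Nonempty)
    {B : ManyBodyOp Λ d₀} (hB : SupportedOn Y B) {Z : Finset Λ} (hZ : Z.Nonempty)
    (hZk : Z.card ≤ k) {A : ManyBodyOp Λ d₀} (hA : SupportedOn Z A) {t : ℝ} (ht : 0 ≤ t) :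
    ‖Dynamics.heisenberg Φ.hamiltonian t A * B - B * Dynamics.heisenberg Φ.hamiltonian t A‖ ≤
      2 * ‖A‖ * (‖B‖ * (Real.exp (-ν * (setDist G Z Y : ℝ)) * Real.exp (κ * t))) := by
  have hlim : Filter.Tendsto (fun N : ℕ => 2 * ‖A‖ * (‖B‖ *
      (Real.exp (-ν * (setDist G Z Y : ℝ)) * Real.exp (κ * t) + (κ * t) ^ N / N.factorial)))
      Filter.atTop (nhds (2 * ‖A‖ * (‖B‖ *
        (Real.exp (-ν * (setDist G Z Y : ℝ)) * Real.exp (κ * t) + 0)))) :=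
    (((FloorSemiring.tendsto_pow_div_factorial_atTop (κ * t)).const_add _).const_mul _).const_mul _
  rw [add_zero] at hlim
  exact ge_of_tendsto' hlim fun N =>
    h.norm_commutator_iterate_le hconn hν hν0 hS hκ hY hB N Z hZ hZk A hA t ht

/-- The local bound requires few sites, so it is applied to the terms crossing the surface of X and
not to A, whose support is arbitrary. The summand 1 keeps the constant positive even if g₀ = 0, and
κ ≥ 1 lets κe^{κs}, an exact derivative, dominate e^{κs}. -/
theorem IsShortRange.norm_commutator_surface_le (h : Φ.IsShortRange G k g g₀ μ₀)
    (hconn : G.Connected) {S ν κ : ℝ} (hν : 4 * ν = μ₀) (hν0 : 0 < ν)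
    (hS : ∀ i, ∑ j, Real.exp (-ν * (G.dist i j : ℝ)) ≤ S)
    (hκ : 2 * (k * (|g| + |g₀| * S)) ≤ κ) (hκ1 : 1 ≤ κ) {X Y : Finset Λ} (hY : Y.Nonempty)
    (hd : 0 < setDist G X Y) {A B : ManyBodyOp Λ d₀} (hA : SupportedOn X A)
    (hB : SupportedOn Y B) (hA1 : ‖A‖ = 1) (hB1 : ‖B‖ = 1) {t : ℝ} (ht : 0 ≤ t) :
    ‖Dynamics.heisenberg Φ.hamiltonian t A * B - B * Dynamics.heisenberg Φ.hamiltonian t A‖ ≤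
      (4 * (|g₀| * S ^ 3) + 1) * (surface G X).card * (Real.exp (κ * t) - 1) *
        Real.exp (-ν * (setDist G X Y : ℝ)) := by
  have hS0 : 0 ≤ S := by
    obtain ⟨i⟩ := hconn.nonempty
    exact (Finset.sum_nonneg fun j _ => (Real.exp_pos _).le).trans (hS i)
  set E := Real.exp (-ν * (setDist G X Y : ℝ)) with hE
  have hb : ∀ s, HasDerivAt (fun s => 2 * ((surface G X).card * (|g₀| * S ^ 3) * E) *
      (Real.exp (κ * s) - 1))
      (2 * ((surface G X).card * (|g₀| * S ^ 3) * E) * (κ * Real.exp (κ * s))) s := by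
    intro s
    have h1 : HasDerivAt (fun s : ℝ => κ * s) κ s := by
      simpa using (hasDerivAt_id s).const_mul κ
    refine ((h1.exp.sub_const 1).const_mul _).congr_deriv ?_
    ring
  refine (norm_commutator_le_of_crossing Φ (disjoint_of_setDist_pos hd) hA hB ht hb
    (by simp) fun s hs => ?_).trans ?_
  · have hs0 : 0 ≤ s := hs.1
    calc ∑ Z ∈ crossing X, ‖Dynamics.heisenberg Φ.hamiltonian s (Φ.term Z) * B -
          B * Dynamics.heisenberg Φ.hamiltonian s (Φ.term Z)‖
        ≤ ∑ Z ∈ crossing X, 2 * ‖Φ.term Z‖ * (‖B‖ *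
            (Real.exp (-ν * (setDist G Z Y : ℝ)) * Real.exp (κ * s))) := by
          refine Finset.sum_le_sum fun Z hZ => ?_
          by_cases hk : Z.card ≤ k
          · obtain ⟨i, hi, -⟩ := Finset.not_disjoint_iff.1 (Finset.mem_filter.1 hZ).2.2
            exact h.norm_commutator_local_le hconn hν hν0 hS hκ hY hB ⟨i, hi⟩ hk
              (Φ.supportedOn Z) hs0
          · simp [h.local_terms Z (not_le.1 hk), Dynamics.heisenberg]
      _ = 2 * Real.exp (κ * s) * ∑ Z ∈ crossing X, ‖Φ.term Z‖ *
            Real.exp (-ν * (setDist G Z Y : ℝ)) := by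
          rw [Finset.mul_sum, hB1]
          refine Finset.sum_congr rfl fun _ _ => by ring
      _ ≤ 2 * Real.exp (κ * s) * ((surface G X).card * (|g₀| * S ^ 3) * E) := by
          gcongr
          exact h.sum_crossing_surface_le hconn hν hν0 hS hY
      _ = 2 * ((surface G X).card * (|g₀| * S ^ 3) * E) * (1 * Real.exp (κ * s)) := by ring
      _ ≤ _ := by gcongr
  · rw [hA1]
    have h1 : 0 ≤ ((surface G X).card : ℝ) * (Real.exp (κ * t) - 1) * E := by
      have : 1 ≤ Real.exp (κ * t) := Real.one_le_exp (by positivity)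
      have : 0 ≤ Real.exp (κ * t) - 1 := by linarith
      positivity
    linarith

theorem IsShortRange.norm_commutator_abs_le (h : Φ.IsShortRange G k g g₀ μ₀)
    (hconn : G.Connected) {S ν κ : ℝ} (hν : 4 * ν = μ₀) (hν0 : 0 < ν)
    (hS : ∀ i, ∑ j, Real.exp (-ν * (G.dist i j : ℝ)) ≤ S)
    (hκ : 2 * (k * (|g| + |g₀| * S)) ≤ κ) (hκ1 : 1 ≤ κ) {X Y : Finset Λ} (hY : Y.Nonempty)
    (hd : 0 < setDist G X Y) {A B : ManyBodyOp Λ d₀} (hA : SupportedOn X A)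
    (hB : SupportedOn Y B) (hA1 : ‖A‖ = 1) (hB1 : ‖B‖ = 1) (t : ℝ) :
    ‖Dynamics.heisenberg Φ.hamiltonian t A * B - B * Dynamics.heisenberg Φ.hamiltonian t A‖ ≤
      (4 * (|g₀| * S ^ 3) + 1) * (surface G X).card * (Real.exp (κ * |t|) - 1) *
        Real.exp (-ν * (setDist G X Y : ℝ)) := by
  rcases le_total 0 t with ht | ht
  · rw [abs_of_nonneg ht]
    exact h.norm_commutator_surface_le hconn hν hν0 hS hκ hκ1 hY hd hA hB hA1 hB1 ht
  · rw [abs_of_nonpos ht]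
    have := h.neg.norm_commutator_surface_le hconn hν hν0 hS hκ hκ1 hY hd hA hB hA1 hB1
      (neg_nonneg.2 ht)
    rwa [neg_hamiltonian, Dynamics.heisenberg_neg_left, neg_neg] at this

/-- The minimum of the two surfaces comes from moving the evolution to the other operator with
reversed time, which preserves the norm of the commutator. -/
theorem IsShortRange.liebRobinson (h : Φ.IsShortRange G k g g₀ μ₀)
    (hconn : G.Connected) {S ν κ : ℝ} (hν : 4 * ν = μ₀) (hν0 : 0 < ν)
    (hS : ∀ i, ∑ j, Real.exp (-ν * (G.dist i j : ℝ)) ≤ S)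
    (hκ : 2 * (k * (|g| + |g₀| * S)) ≤ κ) (hκ1 : 1 ≤ κ) :
    Φ.LiebRobinson G (4 * (|g₀| * S ^ 3) + 1) κ ν := by
  intro X Y hX hY hd A B hA hB hA1 hB1 t
  rw [evolve_eq_heisenberg]
  rcases le_total (surface G X).card (surface G Y).card with hle | hle
  · rw [min_eq_left hle]
    exact h.norm_commutator_abs_le hconn hν hν0 hS hκ hκ1 hY hd hA hB hA1 hB1 t
  · rw [min_eq_right hle, Dynamics.norm_commutator_heisenberg_symm Φ.isSelfAdjoint_hamiltonian,
      setDist_comm, ← abs_neg t]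
    exact h.norm_commutator_abs_le hconn hν hν0 hS hκ hκ1 hX (by rwa [setDist_comm]) hB hA
      hB1 hA1 (-t)

end LiebRobinsonBound

theorem exists_liebRobinson (D k : ℕ) (γ g g₀ μ₀ : ℝ) (hγ : 0 ≤ γ) (hμ₀ : 0 < μ₀) :
    ∃ C v μ : ℝ, 0 < C ∧ 0 < v ∧ 0 < μ ∧
      ∀ (Λ : Type) [Fintype Λ] [DecidableEq Λ] (G : SimpleGraph Λ) (d₀ : ℕ)
        (Φ : Interaction Λ d₀),
        G.Connected → HasGrowth G D γ → 1 ≤ d₀ → Φ.IsShortRange G k g g₀ μ₀ →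
          Φ.LiebRobinson G C v μ := by
  set S : ℝ := 1 + γ * (D.factorial : ℝ) * (μ₀ / 4)⁻¹ ^ D with hS
  have hS0 : 0 ≤ S := by positivity
  refine ⟨4 * (|g₀| * S ^ 3) + 1, 2 * (k * (|g| + |g₀| * S)) + 1, μ₀ / 4, by positivity,
    by positivity, by positivity, ?_⟩
  intro Λ _ _ G d₀ Φ hconn hG _ h
  refine h.liebRobinson hconn (by ring) (by positivity)
    (sum_univ_exp_neg_dist_le hconn hγ hG (by positivity)) (by linarith) ?_
  have : 0 ≤ 2 * (k * (|g| + |g₀| * S)) := by positivity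
  linarith

end Interaction
end

/-! ### Matrices in an eigenbasis and the spectrum of the Gibbs state -/

noncomputable section

namespace SpectralForm

open Matrix

section

variable {n : Type*} [Fintype n] [DecidableEq n]

/-- The matrix of `A` in the orthonormal basis given by the columns of `U`. -/
def inBasis (U : unitaryGroup n ℂ) (A : Matrix n n ℂ) : Matrix n n ℂ :=
  (star U : Matrix n n ℂ) * A * (U : Matrix n n ℂ)

theorem inBasis_mul (U : unitaryGroup n ℂ) (A B : Matrix n n ℂ) :
    inBasis U (A * B) = inBasis U A * inBasis U B := by
  have h : (U : Matrix n n ℂ) * (star U : Matrix n n ℂ) = 1 := Unitary.coe_mul_star_self U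
  calc inBasis U (A * B) = (star U : Matrix n n ℂ) * A *
        ((U : Matrix n n ℂ) * (star U : Matrix n n ℂ)) * B * (U : Matrix n n ℂ) := by
        rw [h, mul_one, inBasis]
        simp only [mul_assoc]
    _ = _ := by simp only [inBasis, mul_assoc]

theorem trace_inBasis (U : unitaryGroup n ℂ) (A : Matrix n n ℂ) :
    (inBasis U A).trace = A.trace := by
  have h : (U : Matrix n n ℂ) * (star U : Matrix n n ℂ) = 1 := Unitary.coe_mul_star_self U
  rw [inBasis, Matrix.trace_mul_comm, ← mul_assoc, h, one_mul]

theorem inBasis_sum {ι : Type*} (U : unitaryGroup n ℂ) (s : Finset ι) (A : ι → Matrix n n ℂ) :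
    inBasis U (∑ i ∈ s, A i) = ∑ i ∈ s, inBasis U (A i) := by
  simp only [inBasis, Finset.mul_sum, Finset.sum_mul]

theorem inBasis_smul (U : unitaryGroup n ℂ) (c : ℂ) (A : Matrix n n ℂ) :
    inBasis U (c • A) = c • inBasis U A := by
  simp only [inBasis, mul_smul_comm, smul_mul_assoc]

theorem inBasis_conjTranspose (U : unitaryGroup n ℂ) (A : Matrix n n ℂ) :
    inBasis U A.conjTranspose = (inBasis U A).conjTranspose := by
  simp only [inBasis, conjTranspose_mul, mul_assoc]
  simp [star_eq_conjTranspose]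

theorem norm_inBasis (U : unitaryGroup n ℂ) (A : Matrix n n ℂ) : ‖inBasis U A‖ = ‖A‖ := by
  rw [inBasis, CStarRing.norm_mul_mem_unitary _ U.2,
    CStarRing.norm_mem_unitary_mul _ (Unitary.star_mem U.2)]

theorem inBasis_eq_iff (U : unitaryGroup n ℂ) (A B : Matrix n n ℂ) :
    inBasis U A = B ↔ A = (U : Matrix n n ℂ) * B * (star U : Matrix n n ℂ) := by
  have h1 : (U : Matrix n n ℂ) * (star U : Matrix n n ℂ) = 1 := Unitary.coe_mul_star_self U
  have h2 : (star U : Matrix n n ℂ) * (U : Matrix n n ℂ) = 1 := Unitary.coe_star_mul_self U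
  constructor
  · rintro rfl
    calc A = ((U : Matrix n n ℂ) * (star U : Matrix n n ℂ)) * A *
          ((U : Matrix n n ℂ) * (star U : Matrix n n ℂ)) := by rw [h1, one_mul, mul_one]
      _ = _ := by simp only [inBasis, mul_assoc]
  · rintro rfl
    calc _ = ((star U : Matrix n n ℂ) * (U : Matrix n n ℂ)) * B *
          ((star U : Matrix n n ℂ) * (U : Matrix n n ℂ)) := by simp only [inBasis, mul_assoc]
      _ = B := by rw [h2, one_mul, mul_one]

theorem inBasis_exp (U : unitaryGroup n ℂ) (A : Matrix n n ℂ) :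
    inBasis U (NormedSpace.exp A) = NormedSpace.exp (inBasis U A) := by
  have := Matrix.exp_units_conj' (Unitary.toUnits U) A
  simpa [inBasis] using this.symm

theorem sum_norm_sq_col_le (A : Matrix n n ℂ) (j : n) : ∑ i, ‖A i j‖ ^ 2 ≤ ‖A‖ ^ 2 := by
  have h := Matrix.l2_opNorm_mulVec A (EuclideanSpace.single j (1 : ℂ))
  rw [PiLp.norm_single, norm_one, mul_one] at h
  have h2 := pow_le_pow_left₀ (norm_nonneg _) h 2
  rw [EuclideanSpace.norm_sq_eq] at h2
  refine le_trans (le_of_eq (Finset.sum_congr rfl fun i _ => ?_)) h2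
  simp

theorem sum_norm_sq_row_le (A : Matrix n n ℂ) (i : n) : ∑ j, ‖A i j‖ ^ 2 ≤ ‖A‖ ^ 2 := by
  have h := sum_norm_sq_col_le A.conjTranspose i
  rw [Matrix.l2_opNorm_conjTranspose] at h
  simpa using h

theorem norm_diag_le (A : Matrix n n ℂ) (i : n) : ‖A i i‖ ≤ ‖A‖ := by
  have h := (Finset.single_le_sum (f := fun j => ‖A i j‖ ^ 2) (fun _ _ => sq_nonneg _)
    (Finset.mem_univ i)).trans (sum_norm_sq_row_le A i)
  exact le_of_sq_le_sq h (norm_nonneg _)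

/-- Cauchy-Schwarz for the pairing of the entries of two contractions against a state. -/
theorem sum_mul_norm_mul_norm_le {p : n → ℝ} (hp : ∀ s, 0 ≤ p s) (hp1 : ∑ s, p s = 1)
    {A B : Matrix n n ℂ} (hA : ‖A‖ ≤ 1) (hB : ‖B‖ ≤ 1) :
    ∑ s, ∑ s', p s * (‖A s s'‖ * ‖B s' s‖) ≤ 1 := by
  rw [← hp1]
  refine Finset.sum_le_sum fun s _ => ?_
  rw [← Finset.mul_sum]
  refine mul_le_of_le_one_right (hp s) ?_
  have h1 := (sum_norm_sq_row_le A s).trans (pow_le_one₀ (norm_nonneg _) hA)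
  have h2 := (sum_norm_sq_col_le B s).trans (pow_le_one₀ (norm_nonneg _) hB)
  calc ∑ s', ‖A s s'‖ * ‖B s' s‖ ≤ ∑ s', (‖A s s'‖ ^ 2 + ‖B s' s‖ ^ 2) / 2 :=
        Finset.sum_le_sum fun s' _ => by nlinarith [sq_nonneg (‖A s s'‖ - ‖B s' s‖)]
    _ = ((∑ s', ‖A s s'‖ ^ 2) + ∑ s', ‖B s' s‖ ^ 2) / 2 := by
        rw [← Finset.sum_div, Finset.sum_add_distrib]
    _ ≤ 1 := by linarith

theorem sum_mul_norm_mul_norm_le' {p : n → ℝ} (hp : ∀ s, 0 ≤ p s) (hp1 : ∑ s, p s = 1)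
    {A B : Matrix n n ℂ} (hA : ‖A‖ ≤ 1) (hB : ‖B‖ ≤ 1) :
    ∑ s, ∑ s', (p s + p s') * (‖A s s'‖ * ‖B s' s‖) ≤ 2 := by
  have h1 := sum_mul_norm_mul_norm_le hp hp1 hA hB
  have h2 := sum_mul_norm_mul_norm_le hp hp1 hB hA
  have h3 : ∑ s, ∑ s', (p s + p s') * (‖A s s'‖ * ‖B s' s‖) =
      (∑ s, ∑ s', p s * (‖A s s'‖ * ‖B s' s‖)) + ∑ s, ∑ s', p s * (‖B s s'‖ * ‖A s' s‖) := by
    rw [Finset.sum_comm (f := fun s s' => p s * (‖B s s'‖ * ‖A s' s‖)),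
      ← Finset.sum_add_distrib]
    refine Finset.sum_congr rfl fun s _ => ?_
    rw [← Finset.sum_add_distrib]
    exact Finset.sum_congr rfl fun s' _ => by ring
  linarith

end

end SpectralForm

namespace ManyBodyOp

open Matrix SpectralForm

variable {Λ : Type} [Fintype Λ] [DecidableEq Λ] {d₀ : ℕ}

theorem inBasis_cfc {ρ : ManyBodyOp Λ d₀} (hρ : ρ.IsHermitian) (f : ℝ → ℝ) :
    inBasis hρ.eigenvectorUnitary (cfc f ρ) =
      diagonal fun s => ((f (hρ.eigenvalues s) : ℝ) : ℂ) := by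
  rw [inBasis_eq_iff, hρ.cfc_eq]
  rfl

theorem inBasis_self {ρ : ManyBodyOp Λ d₀} (hρ : ρ.IsHermitian) :
    inBasis hρ.eigenvectorUnitary ρ = diagonal fun s => ((hρ.eigenvalues s : ℝ) : ℂ) := by
  rw [inBasis_eq_iff]
  exact hρ.spectral_theorem

/-- The Hamiltonian in an eigenbasis of its Gibbs state. -/
theorem exists_energies [Nonempty (Λ → Fin d₀)] {H : ManyBodyOp Λ d₀} (hH : H.IsHermitian)
    {β : ℝ} (hβ : 0 < β) (hρ : (gibbs H β).IsHermitian) :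
    ∃ (E : (Λ → Fin d₀) → ℝ) (Z : ℝ), 0 < Z ∧
      (∀ s, hρ.eigenvalues s = Real.exp (-β * E s) / Z) ∧ (∑ s, hρ.eigenvalues s = 1) ∧
      inBasis hρ.eigenvectorUnitary H = diagonal fun s => ((E s : ℝ) : ℂ) := by
  set U := hρ.eigenvectorUnitary with hU
  set K : ManyBodyOp Λ d₀ := (-β) • H with hK
  have hKs : IsSelfAdjoint K := (IsSelfAdjoint.all (-β)).smul hH.isSelfAdjoint
  have hexp : NormedSpace.exp K = cfc Real.exp K := (CFC.real_exp_eq_normedSpace_exp hKs).symm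
  obtain ⟨Z, hZ, htr⟩ : ∃ Z : ℝ, 0 < Z ∧ (NormedSpace.exp K).trace = Z := by
    have hKh : K.IsHermitian := hKs
    refine ⟨∑ s, Real.exp (hKh.eigenvalues s), Finset.sum_pos (fun s _ => Real.exp_pos _)
      Finset.univ_nonempty, ?_⟩
    rw [hexp, ← trace_inBasis hKh.eigenvectorUnitary, inBasis_cfc, Matrix.trace_diagonal]
    push_cast
    rfl
  have hρK : NormedSpace.exp K = Z • gibbs H β := by
    rw [gibbs, ← hK, htr, ← Complex.coe_smul, smul_smul, mul_inv_cancel₀, one_smul]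
    exact_mod_cast hZ.ne'
  -- Although the eigenbasis is one chosen for the Gibbs state and not for H, it diagonalizes H too,
  -- because H is a function of that state through the logarithm.
  have hlog : K = cfc (fun x : ℝ => Real.log (Z * x)) (gibbs H β) := by
    have h1 : CFC.log (NormedSpace.exp K) = K := CFC.log_exp K hKs
    rw [← h1, hρK, CFC.log]
    refine (cfc_comp_smul Z Real.log (gibbs H β) ?_ hρ.isSelfAdjoint).symm
    exact (Matrix.finite_real_spectrum.image _).continuousOn _
  have hKU : inBasis U K = diagonal fun s => ((Real.log (Z * hρ.eigenvalues s) : ℝ) : ℂ) := by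
    conv_lhs => rw [hlog]
    exact inBasis_cfc hρ _
  -- Two diagonalizations of e^K are compared. This shows that the logarithm is taken at positive
  -- numbers and not at its default values.
  have hev : ∀ s, Real.exp (Real.log (Z * hρ.eigenvalues s)) = Z * hρ.eigenvalues s := by
    intro s
    have h1 : inBasis U (NormedSpace.exp K) =
        diagonal fun s => ((Real.exp (Real.log (Z * hρ.eigenvalues s)) : ℝ) : ℂ) := by
      rw [inBasis_exp, hKU, Matrix.exp_diagonal]
      congr 1
      ext s
      rw [Pi.coe_exp, ← Complex.exp_eq_exp_ℂ, Complex.ofReal_exp]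
    have h2 : inBasis U (NormedSpace.exp K) =
        diagonal fun s => ((Z * hρ.eigenvalues s : ℝ) : ℂ) := by
      rw [hρK, ← Complex.coe_smul, inBasis_smul, inBasis_self hρ, ← diagonal_smul]
      congr 1
      ext s
      simp
    rw [h1] at h2
    exact_mod_cast congrFun (diagonal_injective h2) s
  refine ⟨fun s => -(Real.log (Z * hρ.eigenvalues s)) / β, Z, hZ, fun s => ?_, ?_, ?_⟩
  · rw [show -β * (-(Real.log (Z * hρ.eigenvalues s)) / β) = Real.log (Z * hρ.eigenvalues s) by
      field_simp, hev]
    field_simp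
  · have h1 : (gibbs H β).trace = 1 := by
      rw [gibbs, ← hK, trace_smul, htr, smul_eq_mul, inv_mul_cancel₀]
      exact_mod_cast hZ.ne'
    rw [hρ.trace_eq_sum_eigenvalues] at h1
    exact Complex.ofReal_injective (by push_cast; exact h1)
  · have hHK : H = ((-β⁻¹ : ℝ) : ℂ) • K := by
      rw [hK, Complex.coe_smul, smul_smul]
      simp [hβ.ne']
    rw [(congrArg (inBasis U) hHK).trans (inBasis_smul U _ K), hKU, ← diagonal_smul]
    congr 1
    ext s
    simp only [Pi.smul_apply, smul_eq_mul]
    push_cast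
    ring

end ManyBodyOp
end

/-! ### The Wigner-Yanase-Dyson form and its decay -/

noncomputable section

namespace SpectralForm

open Matrix

variable {n : Type*} [Fintype n]

/-- The symmetrized Wigner-Yanase-Dyson form of a state with eigenvalues `p`, for operators given
by their matrices in an eigenbasis. -/
def wydForm (p : n → ℝ) (α : ℝ) (A B : Matrix n n ℂ) : ℂ :=
  ∑ s, ∑ s', ((1 / 2 * ((p s ^ (1 - α) - p s' ^ (1 - α)) * (p s ^ α - p s' ^ α)) : ℝ) : ℂ) *
    (A s s' * B s' s)

theorem wydForm_sum_left {ι : Type*} (p : n → ℝ) (α : ℝ) (t : Finset ι)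
    (A : ι → Matrix n n ℂ) (B : Matrix n n ℂ) :
    wydForm p α (∑ i ∈ t, A i) B = ∑ i ∈ t, wydForm p α (A i) B := by
  simp only [wydForm, Matrix.sum_apply, Finset.sum_mul, Finset.mul_sum]
  symm
  rw [Finset.sum_comm]
  refine Finset.sum_congr rfl fun s _ => ?_
  rw [Finset.sum_comm]

theorem wydForm_sum_right {ι : Type*} (p : n → ℝ) (α : ℝ) (t : Finset ι)
    (A : Matrix n n ℂ) (B : ι → Matrix n n ℂ) :
    wydForm p α A (∑ i ∈ t, B i) = ∑ i ∈ t, wydForm p α A (B i) := by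
  simp only [wydForm, Matrix.sum_apply, Finset.mul_sum]
  symm
  rw [Finset.sum_comm]
  refine Finset.sum_congr rfl fun s _ => ?_
  rw [Finset.sum_comm]

theorem rpow_one_sub_mul_rpow {x : ℝ} (hx : 0 < x) (α : ℝ) : x ^ (1 - α) * x ^ α = x := by
  rw [← Real.rpow_add hx, sub_add_cancel, Real.rpow_one]

/-- The product of the two entries of A is symmetric in s and s', so averaging the right-hand side
with its index swap gives the product of differences. -/
theorem wydForm_eq {p : n → ℝ} (hp : ∀ s, 0 < p s) (α : ℝ) (A : Matrix n n ℂ) :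
    wydForm p α A A = ∑ s, ∑ s', ((p s : ℝ) : ℂ) * (A s s' * A s' s) -
      ∑ s, ∑ s', ((p s ^ (1 - α) * p s' ^ α : ℝ) : ℂ) * (A s s' * A s' s) := by
  set T : n → n → ℂ := fun s s' => ((p s : ℝ) : ℂ) * (A s s' * A s' s) -
    ((p s ^ (1 - α) * p s' ^ α : ℝ) : ℂ) * (A s s' * A s' s) with hT
  have h1 : ∑ s, ∑ s', ((p s : ℝ) : ℂ) * (A s s' * A s' s) -
      ∑ s, ∑ s', ((p s ^ (1 - α) * p s' ^ α : ℝ) : ℂ) * (A s s' * A s' s) =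
      ∑ s, ∑ s', T s s' := by
    rw [← Finset.sum_sub_distrib]
    exact Finset.sum_congr rfl fun s _ => (Finset.sum_sub_distrib _ _).symm
  have h2 : wydForm p α A A = 1 / 2 * ((∑ s, ∑ s', T s s') + ∑ s, ∑ s', T s' s) := by
    rw [wydForm, ← Finset.sum_add_distrib, Finset.mul_sum]
    refine Finset.sum_congr rfl fun s _ => ?_
    rw [← Finset.sum_add_distrib, Finset.mul_sum]
    refine Finset.sum_congr rfl fun s' _ => ?_
    have e1 : (((p s ^ (1 - α) * p s ^ α : ℝ)) : ℂ) = p s := by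
      rw [rpow_one_sub_mul_rpow (hp s)]
    have e2 : (((p s' ^ (1 - α) * p s' ^ α : ℝ)) : ℂ) = p s' := by
      rw [rpow_one_sub_mul_rpow (hp s')]
    simp only [hT]
    rw [← e1, ← e2]
    push_cast
    ring
  rw [h1, h2, Finset.sum_comm (f := fun s s' => T s' s)]
  ring

/-- With x = √p and y = √q, (x² - y²)² = (x - y)²(x + y)² ≤ 2(x² + y²)(x - y)². For the pair K, K†
all terms of the form are nonnegative, so its norm is the sum itself. -/
theorem sum_fisher_le {p : n → ℝ} (hp : ∀ s, 0 < p s) (K : Matrix n n ℂ) :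
    ∑ s, ∑ s', 2 * (p s - p s') ^ 2 / (p s + p s') * ‖K s s'‖ ^ 2 ≤
      8 * ‖wydForm p (1 / 2) K K.conjTranspose‖ := by
  have h1 : wydForm p (1 / 2) K K.conjTranspose =
      ((∑ s, ∑ s', 1 / 2 * ((√(p s) - √(p s')) ^ 2 * ‖K s s'‖ ^ 2) : ℝ) : ℂ) := by
    rw [wydForm]
    push_cast
    refine Finset.sum_congr rfl fun s _ => Finset.sum_congr rfl fun s' _ => ?_
    rw [conjTranspose_apply, Complex.star_def, Complex.mul_conj']
    rw [show (1 : ℝ) - 1 / 2 = 1 / 2 by norm_num, ← Real.sqrt_eq_rpow, ← Real.sqrt_eq_rpow]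
    ring
  rw [h1, Complex.norm_real]
  refine le_trans ?_ (mul_le_mul_of_nonneg_left (le_abs_self _) (by norm_num))
  rw [Finset.mul_sum]
  refine Finset.sum_le_sum fun s _ => ?_
  rw [Finset.mul_sum]
  refine Finset.sum_le_sum fun s' _ => ?_
  have hs := Real.sq_sqrt (hp s).le
  have hs' := Real.sq_sqrt (hp s').le
  have key : 2 * (p s - p s') ^ 2 / (p s + p s') ≤ 4 * (√(p s) - √(p s')) ^ 2 := by
    rw [div_le_iff₀ (add_pos (hp s) (hp s'))]
    generalize √(p s) = x at *
    generalize √(p s') = y at *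
    rw [← hs, ← hs']
    nlinarith [sq_nonneg ((x - y) ^ 2)]
  calc _ ≤ 4 * (√(p s) - √(p s')) ^ 2 * ‖K s s'‖ ^ 2 := by gcongr
    _ = _ := by ring

variable [DecidableEq n]

/-- Both differences have the same sign, and dropping the cross terms bounds their product by p_s +
p_{s'}. This covers operators at the same site, where commutators give nothing. -/
theorem norm_wydForm_le {p : n → ℝ} (hp : ∀ s, 0 < p s) (hp1 : ∑ s, p s = 1) {α : ℝ}
    (h0 : 0 ≤ α) (h1 : α ≤ 1) {A B : Matrix n n ℂ} (hA : ‖A‖ ≤ 1) (hB : ‖B‖ ≤ 1) :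
    ‖wydForm p α A B‖ ≤ 1 := by
  have h2 := sum_mul_norm_mul_norm_le' (fun s => (hp s).le) hp1 hA hB
  have h3 : ‖wydForm p α A B‖ ≤
      1 / 2 * ∑ s, ∑ s', (p s + p s') * (‖A s s'‖ * ‖B s' s‖) := by
    rw [wydForm, Finset.mul_sum]
    refine (norm_sum_le _ _).trans (Finset.sum_le_sum fun s _ => ?_)
    rw [Finset.mul_sum]
    refine (norm_sum_le _ _).trans (Finset.sum_le_sum fun s' _ => ?_)
    rw [norm_mul, norm_mul, Complex.norm_real, Real.norm_eq_abs,
      ← mul_assoc (1 / 2) (p s + p s')]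
    refine mul_le_mul_of_nonneg_right ?_ (by positivity)
    rw [abs_mul, abs_of_nonneg (by norm_num : (0 : ℝ) ≤ 1 / 2)]
    gcongr
    have e1 := rpow_one_sub_mul_rpow (hp s) α
    have e2 := rpow_one_sub_mul_rpow (hp s') α
    have q1 := Real.rpow_nonneg (hp s).le (1 - α)
    have q2 := Real.rpow_nonneg (hp s).le α
    have q3 := Real.rpow_nonneg (hp s').le (1 - α)
    have q4 := Real.rpow_nonneg (hp s').le α
    have q5 := mul_nonneg q1 q4
    have q6 := mul_nonneg q3 q2
    have hsign : 0 ≤ (p s ^ (1 - α) - p s' ^ (1 - α)) * (p s ^ α - p s' ^ α) := by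
      rcases le_total (p s) (p s') with h | h
      · exact mul_nonneg_of_nonpos_of_nonpos
          (sub_nonpos.2 (Real.rpow_le_rpow (hp s).le h (by linarith)))
          (sub_nonpos.2 (Real.rpow_le_rpow (hp s).le h h0))
      · exact mul_nonneg
          (sub_nonneg.2 (Real.rpow_le_rpow (hp s').le h (by linarith)))
          (sub_nonneg.2 (Real.rpow_le_rpow (hp s').le h h0))
    rw [abs_of_nonneg hsign]
    nlinarith
  linarith

/-- The left side is the expectation of the commutator in the state with weights p: diagonal entries
are bounded by the norm. -/
theorem sum_sub_mul_mul_le {p : n → ℝ} (hp : ∀ s, 0 ≤ p s) (hp1 : ∑ s, p s = 1)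
    (X B : Matrix n n ℂ) :
    ‖∑ s, ∑ s', ((p s - p s' : ℝ) : ℂ) * (X s s' * B s' s)‖ ≤ ‖X * B - B * X‖ := by
  have h : ∑ s, ∑ s', ((p s - p s' : ℝ) : ℂ) * (X s s' * B s' s) =
      ∑ s, ((p s : ℝ) : ℂ) * (X * B - B * X) s s := by
    simp only [Matrix.sub_apply, Matrix.mul_apply, mul_sub, Finset.mul_sum, Complex.ofReal_sub,
      sub_mul, Finset.sum_sub_distrib]
    congr 1
    rw [Finset.sum_comm]
    refine Finset.sum_congr rfl fun s _ => Finset.sum_congr rfl fun s' _ => by ring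
  rw [h]
  calc _ ≤ ∑ s, p s * ‖X * B - B * X‖ := by
        refine (norm_sum_le _ _).trans (Finset.sum_le_sum fun s _ => ?_)
        rw [norm_mul, Complex.norm_real, Real.norm_of_nonneg (hp s)]
        exact mul_le_mul_of_nonneg_left (norm_diag_le _ s) (hp s)
    _ = _ := by rw [← Finset.sum_mul, hp1, one_mul]

theorem inBasis_propagator {U : unitaryGroup n ℂ} {H : Matrix n n ℂ} {E : n → ℝ}
    (hH : inBasis U H = diagonal fun s => ((E s : ℝ) : ℂ)) (t : ℝ) :
    inBasis U (Dynamics.propagator H t) =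
      diagonal fun s => Complex.exp (Complex.I * t * E s) := by
  have h : inBasis U (Dynamics.propagator H t) =
      NormedSpace.exp (inBasis U ((Complex.I * t) • H)) := inBasis_exp U _
  rw [h, inBasis_smul, hH, ← diagonal_smul, Matrix.exp_diagonal]
  congr 1
  ext s
  rw [Pi.coe_exp, ← Complex.exp_eq_exp_ℂ]
  rfl

theorem inBasis_heisenberg_apply {U : unitaryGroup n ℂ} {H : Matrix n n ℂ} {E : n → ℝ}
    (hH : inBasis U H = diagonal fun s => ((E s : ℝ) : ℂ)) (t : ℝ) (A : Matrix n n ℂ) (s s' : n) :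
    inBasis U (Dynamics.heisenberg H t A) s s' =
      Complex.exp (Complex.I * (t * (E s - E s'))) * inBasis U A s s' := by
  rw [Dynamics.heisenberg, inBasis_mul, inBasis_mul, inBasis_propagator hH, inBasis_propagator hH,
    mul_diagonal, diagonal_mul, mul_right_comm, ← Complex.exp_add]
  push_cast
  ring_nf

/-- Decay of the Wigner-Yanase-Dyson form of two operators whose commutator grows slowly. -/
theorem norm_wydForm_le_of_commutator {U : unitaryGroup n ℂ} {H : Matrix n n ℂ} {E p : n → ℝ}
    (hH : inBasis U H = diagonal fun s => ((E s : ℝ) : ℂ)) {β Z : ℝ} (hβ : 0 < β) (hZ : 0 < Z)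
    (hp : ∀ s, p s = Real.exp (-β * E s) / Z) (hp1 : ∑ s, p s = 1) {α : ℝ} (h0 : 0 ≤ α)
    (h1 : α ≤ 1) {A B : Matrix n n ℂ} (hA : ‖A‖ ≤ 1) (hB : ‖B‖ ≤ 1) {c v b : ℝ} (hc : 0 ≤ c)
    (hv : 0 < v) (hb : 0 < b)
    (hcomm : ∀ t : ℝ, ‖Dynamics.heisenberg H t A * B - B * Dynamics.heisenberg H t A‖ ≤
      c * (Real.exp (v * |t|) - 1)) :
    ‖wydForm p α (inBasis U A) (inBasis U B)‖ ≤
      (1 + 2 / Real.pi) * Real.exp (-(Real.pi * b / β)) +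
        2 / Real.pi * c * (Real.exp (v * b) - 1) := by
  have hppos : ∀ s, 0 < p s := fun s => by rw [hp]; positivity
  set A' := inBasis U A with hA'
  set B' := inBasis U B with hB'
  have hA1 : ‖A'‖ ≤ 1 := by rwa [hA', norm_inBasis]
  have hB1 : ‖B'‖ ≤ 1 := by rwa [hB', norm_inBasis]
  set m : n × n → ℂ := fun q => ((1 / 2 * (p q.1 - p q.2) : ℝ) : ℂ) * (A' q.1 q.2 * B' q.2 q.1)
    with hm
  set ω : n × n → ℝ := fun q => E q.2 - E q.1 with hω
  have hform : wydForm p α A' B' =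
      ∑ q, m q * ((SpectralFilter.filter α (β * ω q / 2) : ℝ) : ℂ) := by
    rw [wydForm, Fintype.sum_prod_type]
    refine Finset.sum_congr rfl fun s _ => Finset.sum_congr rfl fun s' _ => ?_
    rw [hp s, hp s', SpectralFilter.rpow_sub_mul_rpow_sub hβ hZ, ← hp, ← hp, hm]
    push_cast
    ring
  have hM : ∑ q, ‖m q‖ ≤ 1 := by
    have h2 := sum_mul_norm_mul_norm_le' (fun s => (hppos s).le) hp1 hA1 hB1
    have h3 : ∑ q, ‖m q‖ ≤
        1 / 2 * ∑ s, ∑ s', (p s + p s') * (‖A' s s'‖ * ‖B' s' s‖) := by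
      rw [Fintype.sum_prod_type, Finset.mul_sum]
      refine Finset.sum_le_sum fun s _ => ?_
      rw [Finset.mul_sum]
      refine Finset.sum_le_sum fun s' _ => ?_
      rw [hm, norm_mul, norm_mul, Complex.norm_real, Real.norm_eq_abs,
      ← mul_assoc (1 / 2) (p s + p s')]
      refine mul_le_mul_of_nonneg_right ?_ (by positivity)
      rw [abs_mul, abs_of_nonneg (by norm_num : (0 : ℝ) ≤ 1 / 2)]
      gcongr
      rw [abs_le]
      constructor <;> linarith [hppos s, hppos s']
    linarith
  -- The sum is ½ tr(ρ[A(-t), B]): the time is reversed because ω is the energy of s' minus that of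
  -- s.
  have hexp : ∀ t : ℝ, ‖∑ q, m q * Complex.exp (Complex.I * (t * ω q))‖ ≤
      c / 2 * (Real.exp (v * |t|) - 1) := by
    intro t
    have h2 : ∑ q, m q * Complex.exp (Complex.I * (t * ω q)) =
        1 / 2 * ∑ s, ∑ s', ((p s - p s' : ℝ) : ℂ) *
          (inBasis U (Dynamics.heisenberg H (-t) A) s s' * B' s' s) := by
      rw [Fintype.sum_prod_type, Finset.mul_sum]
      refine Finset.sum_congr rfl fun s _ => ?_
      rw [Finset.mul_sum]
      refine Finset.sum_congr rfl fun s' _ => ?_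
      rw [inBasis_heisenberg_apply hH, hm]
      have e : Complex.I * (((-t : ℝ) : ℂ) * ((E s : ℂ) - E s')) =
          Complex.I * (t * ((E s' - E s : ℝ) : ℂ)) := by
        push_cast; ring
      simp only [hω, hA', e]
      push_cast
      ring
    rw [h2, norm_mul]
    have h3 := sum_sub_mul_mul_le (fun s => (hppos s).le) hp1
      (inBasis U (Dynamics.heisenberg H (-t) A)) B'
    rw [hB', ← inBasis_mul, ← inBasis_mul] at h3
    have h4 : inBasis U (Dynamics.heisenberg H (-t) A * B) -
        inBasis U (B * Dynamics.heisenberg H (-t) A) =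
        inBasis U (Dynamics.heisenberg H (-t) A * B - B * Dynamics.heisenberg H (-t) A) := by
      simp only [inBasis, mul_sub, sub_mul]
    rw [h4, norm_inBasis] at h3
    have h5 := h3.trans (hcomm (-t))
    rw [abs_neg] at h5
    calc _ ≤ ‖(1 / 2 : ℂ)‖ * (c * (Real.exp (v * |t|) - 1)) := by gcongr
      _ = _ := by norm_num; ring
  have hT : ∀ t : ℝ, 0 < t → t ≤ b →
      ‖∑ q, m q * (Real.sin (ω q * t) : ℂ)‖ ≤ c / 2 * (Real.exp (v * t) - 1) := by
    intro t ht _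
    have hsin : ∑ q, m q * (Real.sin (ω q * t) : ℂ) = Complex.I / 2 *
        (∑ q, m q * Complex.exp (Complex.I * (((-t : ℝ) : ℂ) * ω q)) -
          ∑ q, m q * Complex.exp (Complex.I * (t * ω q))) := by
      rw [← Finset.sum_sub_distrib, Finset.mul_sum]
      refine Finset.sum_congr rfl fun q _ => ?_
      rw [Complex.ofReal_sin, Complex.sin]
      push_cast
      rw [show -((ω q : ℂ) * t) * Complex.I = Complex.I * (-(t : ℂ) * ω q) by ring,
        show (ω q : ℂ) * t * Complex.I = Complex.I * (t * ω q) by ring]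
      ring
    rw [hsin, norm_mul]
    have e1 := hexp t
    have e2 := hexp (-t)
    rw [abs_neg] at e2
    rw [abs_of_pos ht] at e1 e2
    have e3 : ‖(Complex.I / 2 : ℂ)‖ = 1 / 2 := by simp
    have e4 := (norm_sub_le (∑ q, m q * Complex.exp (Complex.I * (((-t : ℝ) : ℂ) * ω q)))
      (∑ q, m q * Complex.exp (Complex.I * (t * ω q)))).trans (add_le_add e2 e1)
    rw [e3]
    linarith
  have hfinal := SpectralFilter.norm_sum_filter_le m ω
    (fun q => SpectralFilter.filter α (β * ω q / 2)) (a := 2 * Real.pi / β) (by positivity) hb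
    (by positivity : 0 ≤ c / 2) hv hM hT (SpectralFilter.weight_zero β α)
    (SpectralFilter.weight_nonneg hβ α) (SpectralFilter.weight_le hβ α)
    (fun q => SpectralFilter.hasSum_filter hβ h0 h1 (ω q))
    (fun q => SpectralFilter.abs_filter_le_one h0 h1 _)
  rw [hform]
  refine hfinal.trans (le_of_eq ?_)
  have : 2 * Real.pi / β * b / 2 = Real.pi * b / β := by ring
  rw [this]
  ring

end SpectralForm
end

/-! ### Clustering in the Gibbs state and summation over sites -/

noncomputable section

namespace ManyBodyOp

open Matrix SpectralForm

variable {Λ : Type} [Fintype Λ] [DecidableEq Λ] {d₀ : ℕ}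

theorem skewInformation_eq_wydForm {ρ : ManyBodyOp Λ d₀} (hρ : ρ.IsHermitian)
    (hpos : ∀ s, 0 < hρ.eigenvalues s) (α : ℝ) (K : ManyBodyOp Λ d₀) :
    skewInformation ρ α K = wydForm hρ.eigenvalues α (inBasis hρ.eigenvectorUnitary K)
      (inBasis hρ.eigenvectorUnitary K) := by
  set U := hρ.eigenvectorUnitary with hU
  have hpow : ∀ s : ℝ, inBasis U (power ρ s) =
      diagonal fun q => ((hρ.eigenvalues q ^ s : ℝ) : ℂ) := fun s => inBasis_cfc hρ _
  rw [wydForm_eq hpos, skewInformation]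
  congr 1
  · rw [← trace_inBasis U, pow_two, inBasis_mul, inBasis_mul, inBasis_self hρ, Matrix.trace]
    refine Finset.sum_congr rfl fun s _ => ?_
    rw [diag_apply, diagonal_mul, mul_apply, Finset.mul_sum]
  · rw [← trace_inBasis U, inBasis_mul, inBasis_mul, inBasis_mul, hpow, hpow, Matrix.trace]
    refine Finset.sum_congr rfl fun s _ => ?_
    rw [diag_apply, mul_apply]
    refine Finset.sum_congr rfl fun s' _ => ?_
    rw [mul_diagonal, diagonal_mul]
    push_cast
    ring

theorem fisherInformation_le_wydForm {ρ : ManyBodyOp Λ d₀} (hρ : ρ.IsHermitian)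
    (hpos : ∀ s, 0 < hρ.eigenvalues s) (K : ManyBodyOp Λ d₀) :
    fisherInformation ρ hρ K ≤ 8 * ‖wydForm hρ.eigenvalues (1 / 2)
      (inBasis hρ.eigenvectorUnitary K) (inBasis hρ.eigenvectorUnitary K.conjTranspose)‖ := by
  rw [inBasis_conjTranspose]
  refine le_trans (le_of_eq ?_) (sum_fisher_le hpos _)
  rw [fisherInformation]
  refine Finset.sum_congr rfl fun s _ => Finset.sum_congr rfl fun s' _ => ?_
  congr 3
  rw [inBasis, mul_assoc, mul_apply]
  refine Finset.sum_congr rfl fun q _ => ?_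
  rw [mul_apply]
  rfl

end ManyBodyOp

namespace SkewBound

theorem xi_eq (v μ β : ℝ) : xi v μ β = (2 + v * β / Real.pi) / μ := by
  rw [xi, inv_div]

theorem isBigO_Ctilde_mul_xi (D : ℕ) (γ : ℝ) {C v μ : ℝ} (hC : 0 < C) (hv : 0 < v)
    (hμ : 0 < μ) :
    (fun β : ℝ => Ctilde D γ C v μ β * xi v μ β ^ D) =O[Filter.atTop] fun β : ℝ => β ^ D := by
  have hC' : (fun β : ℝ => Ctilde D γ C v μ β) =O[Filter.atTop] fun _ : ℝ => (1 : ℝ) := by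
    refine Asymptotics.IsBigO.of_bound
      (((12 + 2 * C) / Real.pi + 4 * C / v) *
        ‖(μ / 2) ^ D + γ * Real.exp (μ / 2) * (D.factorial : ℝ)‖) ?_
    filter_upwards [Filter.eventually_ge_atTop 1] with β hβ
    rw [Ctilde, norm_mul, norm_one, mul_one, C']
    gcongr
    rw [Real.norm_of_nonneg (by positivity)]
    gcongr
    exact le_mul_of_one_le_right hv.le hβ
  have hxi : (fun β : ℝ => xi v μ β) =O[Filter.atTop] fun β : ℝ => β := by
    refine Asymptotics.IsBigO.of_bound ((2 + v / Real.pi) / μ) ?_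
    filter_upwards [Filter.eventually_ge_atTop 1] with β hβ
    rw [xi_eq, Real.norm_of_nonneg (by positivity), Real.norm_of_nonneg (by positivity),
      div_mul_eq_mul_div]
    gcongr
    rw [add_mul, div_mul_eq_mul_div]
    linarith
  simpa using hC'.mul (hxi.pow D)

end SkewBound

namespace Interaction

open Lattice ManyBodyOp SpectralForm

variable {Λ : Type} [Fintype Λ] [DecidableEq Λ] {d₀ : ℕ} {Φ : Interaction Λ d₀}
  {G : SimpleGraph Λ} {C v μ : ℝ}

/-- Operators of norm at most 1 are rescaled to unit norm, which only increases the commutator; zero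
operators are treated apart. The surface of a single site has at most one element. -/
theorem LiebRobinson.norm_commutator_site_le (h : Φ.LiebRobinson G C v μ) (hC : 0 < C)
    (hv : 0 < v) (hconn : G.Connected) {i j : Λ} (hij : i ≠ j) {A B : ManyBodyOp Λ d₀}
    (hA : SupportedOn {i} A) (hB : SupportedOn {j} B) (hA1 : ‖A‖ ≤ 1) (hB1 : ‖B‖ ≤ 1) (t : ℝ) :
    ‖Dynamics.heisenberg Φ.hamiltonian t A * B - B * Dynamics.heisenberg Φ.hamiltonian t A‖ ≤
      C * Real.exp (-μ * (G.dist i j : ℝ)) * (Real.exp (v * |t|) - 1) := by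
  have hexp : 0 ≤ Real.exp (v * |t|) - 1 := by
    have : 1 ≤ Real.exp (v * |t|) := Real.one_le_exp (by positivity)
    linarith
  rcases eq_or_ne A 0 with rfl | hA0
  · simp only [Dynamics.heisenberg, mul_zero, zero_mul, sub_self, norm_zero]
    positivity
  rcases eq_or_ne B 0 with rfl | hB0
  · simp only [mul_zero, zero_mul, sub_self, norm_zero]
    positivity
  have hAn : ‖A‖ ≠ 0 := norm_ne_zero_iff.2 hA0
  have hBn : ‖B‖ ≠ 0 := norm_ne_zero_iff.2 hB0
  have hunit : ∀ M : ManyBodyOp Λ d₀, ‖M‖ ≠ 0 → ‖((‖M‖⁻¹ : ℝ) : ℂ) • M‖ = 1 := by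
    intro M hM
    rw [norm_smul, Complex.norm_real, Real.norm_of_nonneg (by positivity), inv_mul_cancel₀ hM]
  have hd : 0 < setDist G {i} {j} := by
    rw [setDist_singleton]
    exact hconn.pos_dist_of_ne hij
  have h1 := h {i} {j} (Finset.singleton_nonempty i) (Finset.singleton_nonempty j) hd _ _
    (hA.smul ((‖A‖⁻¹ : ℝ) : ℂ)) (hB.smul ((‖B‖⁻¹ : ℝ) : ℂ)) (hunit A hAn) (hunit B hBn) t
  rw [evolve_eq_heisenberg, Dynamics.heisenberg_smul, setDist_singleton, smul_mul_smul_comm,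
    smul_mul_smul_comm, mul_comm ((‖B‖⁻¹ : ℝ) : ℂ), ← smul_sub, norm_smul, norm_mul,
    Complex.norm_real, Complex.norm_real, Real.norm_of_nonneg (by positivity),
    Real.norm_of_nonneg (by positivity)] at h1
  have hcard : ((min (surface G {i}).card (surface G {j}).card : ℕ) : ℝ) ≤ 1 := by
    exact_mod_cast (min_le_left _ _).trans (card_surface_singleton_le G i)
  set N := ‖Dynamics.heisenberg Φ.hamiltonian t A * B -
    B * Dynamics.heisenberg Φ.hamiltonian t A‖ with hN
  have hN0 : 0 ≤ N := norm_nonneg _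
  have hone : 1 ≤ ‖A‖⁻¹ * ‖B‖⁻¹ :=
    one_le_mul_of_one_le_of_one_le ((one_le_inv₀ (by positivity)).2 hA1)
      ((one_le_inv₀ (by positivity)).2 hB1)
  calc N ≤ ‖A‖⁻¹ * ‖B‖⁻¹ * N := le_mul_of_one_le_left hN0 hone
    _ ≤ _ := h1
    _ ≤ C * 1 * (Real.exp (v * |t|) - 1) * Real.exp (-μ * (G.dist i j : ℝ)) := by gcongr
    _ = _ := by ring

/-- Exponential clustering of the Wigner-Yanase-Dyson form in a thermal state. -/
theorem LiebRobinson.norm_wydForm_le (h : Φ.LiebRobinson G C v μ) (hC : 0 < C) (hv : 0 < v)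
    (hμ : 0 < μ) (hconn : G.Connected) (hd₀ : 1 ≤ d₀) {β : ℝ} (hβ : 0 < β) {α : ℝ} (h0 : 0 ≤ α)
    (h1 : α ≤ 1) {i j : Λ} {A B : ManyBodyOp Λ d₀}
    (hA : SupportedOn {i} A) (hB : SupportedOn {j} B) (hA1 : ‖A‖ ≤ 1) (hB1 : ‖B‖ ≤ 1) :
    ‖wydForm (Φ.isHermitian_gibbs β).eigenvalues α
        (inBasis (Φ.isHermitian_gibbs β).eigenvectorUnitary A)
        (inBasis (Φ.isHermitian_gibbs β).eigenvectorUnitary B)‖ ≤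
      SkewBound.C' C v β * Real.exp (-(SkewBound.xi v μ β)⁻¹ * (G.dist i j : ℝ)) := by
  have : Nonempty (Λ → Fin d₀) := ⟨fun _ => ⟨0, hd₀⟩⟩
  obtain ⟨E, Z, hZ, hp, hp1, hH⟩ :=
    exists_energies Φ.isHermitian_hamiltonian hβ (Φ.isHermitian_gibbs β)
  have hpos : ∀ s, 0 < (Φ.isHermitian_gibbs β).eigenvalues s := fun s =>
    (div_pos (Real.exp_pos _) hZ).trans_eq (hp s).symm
  have hπ := Real.pi_pos
  -- The contributions of the cut and of the short times add up to 1 + 2/π + 2C/π, and π + 2 ≤ 12;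
  -- the term 4C/(vβ) is pure slack.
  have hC'1 : (1 + 2 / Real.pi) + 2 * C / Real.pi ≤ SkewBound.C' C v β := by
    have e1 : 0 ≤ 4 * C / (v * β) := by positivity
    have e2 : (1 + 2 / Real.pi) + 2 * C / Real.pi ≤ (12 + 2 * C) / Real.pi := by
      rw [← sub_nonneg, show (12 + 2 * C) / Real.pi - ((1 + 2 / Real.pi) + 2 * C / Real.pi) =
        (10 - Real.pi) / Real.pi by field_simp; ring]
      have := Real.pi_le_four
      exact div_nonneg (by linarith) hπ.le
    rw [SkewBound.C']
    linarith
  rcases eq_or_ne i j with rfl | hij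
  · have h2 := SpectralForm.norm_wydForm_le hpos hp1 h0 h1
      (A := inBasis (Φ.isHermitian_gibbs β).eigenvectorUnitary A)
      (B := inBasis (Φ.isHermitian_gibbs β).eigenvectorUnitary B)
      (by rwa [norm_inBasis]) (by rwa [norm_inBasis])
    refine h2.trans ?_
    have : 0 ≤ 2 / Real.pi + 2 * C / Real.pi := by positivity
    simp only [SimpleGraph.dist_self, Nat.cast_zero, mul_zero, Real.exp_zero, mul_one]
    linarith
  · have hd : 0 < (G.dist i j : ℝ) := by exact_mod_cast hconn.pos_dist_of_ne hij
    set d : ℝ := (G.dist i j : ℝ) with hdd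
    set ξ := SkewBound.xi v μ β with hξ
    have hξ0 : 0 < ξ := by rw [hξ, SkewBound.xi_eq]; positivity
    have hξμ : ξ * μ = 2 + v * β / Real.pi := by
      rw [hξ, SkewBound.xi_eq, div_mul_cancel₀ _ hμ.ne']
    -- The cutoff time makes e^{-πb/β} equal to e^{-d/ξ}. Since μ = (2 + vβ/π)/ξ and vb =
    -- (d/ξ)(vβ/π), the other exponent is -μd + vb = -2d/ξ, which is more than enough.
    set b := β * d / (Real.pi * ξ) with hb
    have hb0 : 0 < b := by positivity
    have h2 := norm_wydForm_le_of_commutator hH hβ hZ hp hp1 h0 h1 hA1 hB1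
      (c := C * Real.exp (-μ * d)) (by positivity) hv hb0
      (h.norm_commutator_site_le hC hv hconn hij hA hB hA1 hB1)
    refine h2.trans ?_
    have e1 : Real.pi * b / β = ξ⁻¹ * d := by
      rw [hb]; field_simp
    have e2 : Real.exp (-μ * d) * (Real.exp (v * b) - 1) ≤ Real.exp (-ξ⁻¹ * d) := by
      have e3 : -μ * d + v * b ≤ -ξ⁻¹ * d := by
        have e4 : μ = ξ⁻¹ * (2 + v * β / Real.pi) := by
          rw [← hξμ]; field_simp
        have e5 : v * b = ξ⁻¹ * d * (v * β / Real.pi) := by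
          rw [hb]; field_simp
        have e6 : 0 ≤ ξ⁻¹ * d := by positivity
        rw [e5]
        nth_rewrite 1 [e4]
        nlinarith
      calc _ = Real.exp (-μ * d + v * b) - Real.exp (-μ * d) := by rw [Real.exp_add]; ring
        _ ≤ Real.exp (-μ * d + v * b) := by linarith [Real.exp_pos (-μ * d)]
        _ ≤ _ := Real.exp_le_exp.2 e3
    rw [e1, ← neg_mul]
    calc _ = (1 + 2 / Real.pi) * Real.exp (-ξ⁻¹ * d) +
          2 * C / Real.pi * (Real.exp (-μ * d) * (Real.exp (v * b) - 1)) := by ring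
      _ ≤ (1 + 2 / Real.pi) * Real.exp (-ξ⁻¹ * d) + 2 * C / Real.pi * Real.exp (-ξ⁻¹ * d) := by
          gcongr
      _ = ((1 + 2 / Real.pi) + 2 * C / Real.pi) * Real.exp (-ξ⁻¹ * d) := by ring
      _ ≤ _ := by gcongr

/-- Two families of operators are allowed because the Fisher information pairs K with K†, while the
skew information pairs K with itself. -/
theorem LiebRobinson.norm_wydForm_sum_le (h : Φ.LiebRobinson G C v μ) (hC : 0 < C) (hv : 0 < v)
    (hμ : 0 < μ) (hconn : G.Connected) {D : ℕ} {γ : ℝ} (hγ : 0 ≤ γ) (hG : HasGrowth G D γ)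
    (hd₀ : 1 ≤ d₀) {β : ℝ} (hβ : 0 < β) {α : ℝ} (h0 : 0 ≤ α)
    (h1 : α ≤ 1) {O P : Λ → ManyBodyOp Λ d₀} (hO : ∀ i, SupportedOn {i} (O i))
    (hP : ∀ i, SupportedOn {i} (P i)) (hO1 : ∀ i, ‖O i‖ ≤ 1) (hP1 : ∀ i, ‖P i‖ ≤ 1) :
    ‖wydForm (Φ.isHermitian_gibbs β).eigenvalues α
        (inBasis (Φ.isHermitian_gibbs β).eigenvectorUnitary (∑ i, O i))
        (inBasis (Φ.isHermitian_gibbs β).eigenvectorUnitary (∑ i, P i))‖ ≤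
      SkewBound.Ctilde D γ C v μ β * SkewBound.xi v μ β ^ D * (Fintype.card Λ : ℝ) := by
  have hπ := Real.pi_pos
  have hξ0 : 0 < SkewBound.xi v μ β := by rw [SkewBound.xi_eq]; positivity
  have hC'0 : 0 ≤ SkewBound.C' C v β := by rw [SkewBound.C']; positivity
  rw [inBasis_sum, inBasis_sum, wydForm_sum_left]
  have hrow : ∀ i, ‖wydForm (Φ.isHermitian_gibbs β).eigenvalues α
        (inBasis (Φ.isHermitian_gibbs β).eigenvectorUnitary (O i))
        (∑ j, inBasis (Φ.isHermitian_gibbs β).eigenvectorUnitary (P j))‖ ≤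
      SkewBound.Ctilde D γ C v μ β * SkewBound.xi v μ β ^ D := by
    intro i
    rw [wydForm_sum_right]
    calc _ ≤ ∑ j, SkewBound.C' C v β *
          Real.exp (-(SkewBound.xi v μ β)⁻¹ * (G.dist i j : ℝ)) :=
          (norm_sum_le _ _).trans (Finset.sum_le_sum fun j _ =>
            h.norm_wydForm_le hC hv hμ hconn hd₀ hβ h0 h1 (hO i) (hP j) (hO1 i) (hP1 j))
      _ ≤ SkewBound.C' C v β *
          (1 + γ * (D.factorial : ℝ) * (SkewBound.xi v μ β)⁻¹⁻¹ ^ D) := by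
          rw [← Finset.mul_sum]
          gcongr
          exact sum_univ_exp_neg_dist_le hconn hγ hG (inv_pos.2 hξ0) i
      _ ≤ SkewBound.C' C v β * ((μ / 2 * SkewBound.xi v μ β) ^ D +
          γ * (D.factorial : ℝ) * SkewBound.xi v μ β ^ D * Real.exp (μ / 2)) := by
          rw [inv_inv]
          refine mul_le_mul_of_nonneg_left (add_le_add ?_ ?_) hC'0
          -- The diagonal term 1 is absorbed in (μξ/2)^D, as μξ = 2 + vβ/π ≥ 2.
          · refine one_le_pow₀ ?_
            rw [SkewBound.xi_eq]
            have : 0 ≤ v * β / Real.pi := by positivity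
            have e : μ / 2 * ((2 + v * β / Real.pi) / μ) = 1 + v * β / Real.pi / 2 := by
              field_simp
            rw [e]
            linarith
          · exact le_mul_of_one_le_right (by positivity) (Real.one_le_exp (by positivity))
      _ = _ := by
          rw [SkewBound.Ctilde, mul_pow]
          ring
  calc _ ≤ ∑ _i : Λ, SkewBound.Ctilde D γ C v μ β * SkewBound.xi v μ β ^ D :=
        (norm_sum_le _ _).trans (Finset.sum_le_sum fun i _ => hrow i)
    _ = _ := by
        rw [Finset.sum_const, nsmul_eq_mul, Finset.card_univ, mul_comm]

end Interaction

end

/-! ### The main theorem -/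

theorem mainTheorem6 (D k : ℕ) (hD : 1 ≤ D) (γ g g₀ μ₀ : ℝ) (hγ : 1 ≤ γ) (hμ₀ : 0 < μ₀) :
    (∃ C v μ : ℝ, 0 < C ∧ 0 < v ∧ 0 < μ ∧
      ∀ (Λ : Type) [Fintype Λ] [DecidableEq Λ] (G : SimpleGraph Λ) (d₀ : ℕ)
        (Φ : Interaction Λ d₀),
        G.Connected → Lattice.HasGrowth G D γ → 1 ≤ d₀ → Φ.IsShortRange G k g g₀ μ₀ →
          Φ.LiebRobinson G C v μ) ∧
    (∀ C v μ : ℝ, 0 < C → 0 < v → 0 < μ →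
      ((fun β : ℝ => SkewBound.Ctilde D γ C v μ β * SkewBound.xi v μ β ^ D)
        =O[Filter.atTop] fun β : ℝ => β ^ D) ∧
      ∀ (Λ : Type) [Fintype Λ] [DecidableEq Λ] (G : SimpleGraph Λ) (d₀ : ℕ)
        (Φ : Interaction Λ d₀),
        G.Connected → Lattice.HasGrowth G D γ → 1 ≤ d₀ → Φ.IsShortRange G k g g₀ μ₀ →
          Φ.LiebRobinson G C v μ →
        ∀ β : ℝ, 0 < β →
        ∀ O : Λ → ManyBodyOp Λ d₀, (∀ i, ManyBodyOp.SupportedOn {i} (O i)) → (∀ i, ‖O i‖ ≤ 1) →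
          (∀ α : ℝ, 0 ≤ α → α ≤ 1 →
            ‖ManyBodyOp.skewInformation (Φ.gibbs β) α (∑ i, O i)‖ ≤
              SkewBound.Ctilde D γ C v μ β * SkewBound.xi v μ β ^ D * (Fintype.card Λ : ℝ)) ∧
          ManyBodyOp.fisherInformation (Φ.gibbs β) (Φ.isHermitian_gibbs β) (∑ i, O i) ≤
            8 * SkewBound.Ctilde D γ C v μ β * SkewBound.xi v μ β ^ D *
              (Fintype.card Λ : ℝ)) := by

  refine ⟨Interaction.exists_liebRobinson D k γ g g₀ μ₀ (by linarith) hμ₀, ?_⟩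
  intro C v μ hC hv hμ
  refine ⟨SkewBound.isBigO_Ctilde_mul_xi D γ hC hv hμ, ?_⟩
  intro Λ _ _ G d₀ Φ hconn hG hd₀ _ hLR β hβ O hO hO1
  have : Nonempty (Λ → Fin d₀) := ⟨fun _ => ⟨0, hd₀⟩⟩
  obtain ⟨E, Z, hZ, hp, -, -⟩ :=
    ManyBodyOp.exists_energies Φ.isHermitian_hamiltonian hβ (Φ.isHermitian_gibbs β)
  have hpos : ∀ s, 0 < (Φ.isHermitian_gibbs β).eigenvalues s := fun s =>
    (div_pos (Real.exp_pos _) hZ).trans_eq (hp s).symm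
  refine ⟨fun α h0 h1 => ?_, ?_⟩
  · rw [ManyBodyOp.skewInformation_eq_wydForm (Φ.isHermitian_gibbs β) hpos]
    exact hLR.norm_wydForm_sum_le hC hv hμ hconn (by linarith) hG hd₀ hβ h0 h1 hO hO hO1 hO1
  · refine (ManyBodyOp.fisherInformation_le_wydForm (Φ.isHermitian_gibbs β) hpos _).trans ?_
    rw [Matrix.conjTranspose_sum, mul_assoc 8, mul_assoc 8]
    refine mul_le_mul_of_nonneg_left ?_ (by norm_num)
    exact hLR.norm_wydForm_sum_le hC hv hμ hconn (by linarith) hG hd₀ hβ (by norm_num)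
      (by norm_num) hO (fun i => (hO i).conjTranspose) hO1
      fun i => by rw [Matrix.l2_opNorm_conjTranspose]; exact hO1 i
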